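/- Let $m\ge 2$ and let $F_n$ be the free group on $x_1,\dots,x_n$. For a group $G$, put $\Gamma_G(1)=G$ and $\Gamma_G(k+1)=[\Gamma_G(k),G]$, and let $$\mathcal A_G(k)=\ker\bigl(\mathrm{Aut}\,G\to\mathrm{Aut}(G/\Gamma_G(k+1))\bigr)\qquad(k\ge1)$$ be the Andreadakis–Johnson filtration of $\mathrm{Aut}\,G$. For $x\in F_n$ and $1\le i,j\le m$, let $a_{ij}(x)$ be the complex-valued function on $\mathrm{Hom}(F_n,\mathrm{SL}(m,\mathbb C))$ sending $\rho$ to the $(i,j)$-entry of $\rho(x)$. Let $\mathfrak R^m_{\mathbb Q}(F_n)$ be the $\mathbb Q$-algebra of functions generated by all $a_{ij}(x)$ with $x\in F_n$, and let $\mathfrak J$ be its ideal generated by the elements $s_{ij}(x_l)=a_{ij}(x_l)-\delta_{ij}$ for $1\le i,j\le m$ and $1\le l\le n$. The group $\mathrm{Aut}\,F_n$ acts on $\mathfrak R^m_{\mathbb Q}(F_n)$ by algebra automorphisms such that $\sigma$ takes $a_{ij}(x)$ to $a_{ij}(x^\sigma)$, where $x^\sigma$ is the image of $x$ under $\sigma$.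 This action preserves $\mathfrak J$ and its powers. Put $$\mathcal D^m_{F_n}(k)=\ker\bigl(\mathrm{Aut}\,F_n\to\mathrm{Aut}(\mathfrak J/\mathfrak J^{k+1})\bigr)\qquad(k\ge1).$$ **Theorem.** For every $n$, every $m\ge2$ and every $1\le k\le4$, $$\mathcal D^m_{F_n}(k)=\mathcal A_{F_n}(k).$$ -/

import Mathlib

/-! ### The Andreadakis-Johnson filtration -/

section AndreadakisJohnson

/-- The natural homomorphism `Aut G → Aut (G ⧸ N)` for a characteristic subgroup `N` of `G`. -/
def autQuotient (G : Type*) [Group G] (N : Subgroup G) [N.Characteristic] :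
    MulAut G →* MulAut (G ⧸ N) where
  toFun σ := QuotientGroup.congr N N σ (Subgroup.characteristic_iff_map_eq.mp inferInstance σ)
  map_one' := by
    ext x
    induction x using QuotientGroup.induction_on with
    | H x => rfl
  map_mul' σ τ := by
    ext x
    induction x using QuotientGroup.induction_on with
    | H x => rfl

/-- The lower central series numbered from one: `Γ_G(1) = G`, `Γ_G(k + 1) = [Γ_G(k), G]`
(Mathlib's `lowerCentralSeries` is numbered from zero). -/
def lowerCentral (G : Type*) [Group G] (k : ℕ) : Subgroup G := (⊤ : Subgroup G).lowerCentralSeries (k - 1)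

instance (G : Type*) [Group G] (k : ℕ) : (lowerCentral G k).Characteristic :=
  inferInstanceAs ((⊤ : Subgroup G).lowerCentralSeries (k - 1)).Characteristic

/-- `𝒜_G(k)`, the kernel of `Aut G → Aut (G ⧸ Γ_G(k + 1))`. -/
def andreadakisJohnson (G : Type*) [Group G] (k : ℕ) : Subgroup (MulAut G) :=
  (autQuotient G (lowerCentral G (k + 1))).ker

end AndreadakisJohnson

/-! ### The `SL(m, ℂ)`-representation algebra of a group -/

section RepresentationAlgebra

/-- `R^m(G) = Hom(G, SL(m, ℂ))`. -/
abbrev SLRep (m : ℕ) (G : Type*) [Group G] : Type _ :=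
  G →* Matrix.SpecialLinearGroup (Fin m) ℂ

/-- The coordinate function `a_ij(x)` on `R^m(G)`, sending `ρ` to the `(i, j)`-entry of `ρ x`. -/
def coordFun {m : ℕ} {G : Type*} [Group G] (i j : Fin m) (x : G) : SLRep m G → ℂ :=
  fun ρ => (ρ x : Matrix (Fin m) (Fin m) ℂ) i j

/-- The representation algebra: the `ℚ`-subalgebra of the algebra of all complex-valued functions
on `R^m(G)` generated by all `a_ij(x)`. -/
noncomputable def repAlgebra (m : ℕ) (G : Type*) [Group G] : Subalgebra ℚ (SLRep m G → ℂ) :=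
  Algebra.adjoin ℚ {f | ∃ (i j : Fin m) (x : G), f = coordFun i j x}

/-- The action of `σ ∈ Aut G` on functions on `R^m(G)`: `χ^σ(ρ) = χ(ρ ∘ σ)`. It satisfies
`a_ij(x)^σ = a_ij(σ x)`. -/
noncomputable def funAct (m : ℕ) {G : Type*} [Group G] (σ : MulAut G) :
    (SLRep m G → ℂ) →ₐ[ℚ] (SLRep m G → ℂ) where
  toFun χ := fun ρ => χ (ρ.comp σ.toMonoidHom)
  map_one' := rfl
  map_mul' _ _ := rfl
  map_zero' := rfl
  map_add' _ _ := rfl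
  commutes' _ := rfl

theorem funAct_coordFun {m : ℕ} {G : Type*} [Group G] (σ : MulAut G) (i j : Fin m) (x : G) :
    funAct m σ (coordFun i j x) = coordFun i j (σ x) := rfl

theorem coordFun_mem {m : ℕ} {G : Type*} [Group G] (i j : Fin m) (x : G) :
    coordFun i j x ∈ repAlgebra m G :=
  Algebra.subset_adjoin ⟨i, j, x, rfl⟩

theorem funAct_mem {m : ℕ} {G : Type*} [Group G] (σ : MulAut G) (f : SLRep m G → ℂ)
    (hf : f ∈ repAlgebra m G) : funAct m σ f ∈ repAlgebra m G := by
  have h : repAlgebra m G ≤ (repAlgebra m G).comap (funAct m σ) := by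
    refine Algebra.adjoin_le ?_
    rintro _ ⟨i, j, x, rfl⟩
    exact coordFun_mem i j (σ x)
  exact h hf

/-- The action of `Aut G` on the representation algebra. -/
noncomputable def repAct (m : ℕ) (G : Type*) [Group G] :
    MulAut G →* (repAlgebra m G →ₐ[ℚ] repAlgebra m G) where
  toFun σ := ((funAct m σ).comp (repAlgebra m G).val).codRestrict (repAlgebra m G)
    (fun f => funAct_mem σ (f : SLRep m G → ℂ) f.2)
  map_one' := rfl
  map_mul' _ _ := rfl

/-- `a_ij(x)` as an element of the representation algebra. -/
noncomputable def repCoord {m : ℕ} {G : Type*} [Group G] (i j : Fin m) (x : G) :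
    repAlgebra m G :=
  ⟨coordFun i j x, coordFun_mem i j x⟩

/-- `s_ij(x) = a_ij(x) - δ_ij`. -/
noncomputable def repS {m : ℕ} {G : Type*} [Group G] (i j : Fin m) (x : G) : repAlgebra m G :=
  repCoord i j x - if i = j then 1 else 0

theorem repAct_repS {m : ℕ} {G : Type*} [Group G] (σ : MulAut G) (i j : Fin m) (x : G) :
    repAct m G σ (repS i j x) = repS i j (σ x) := by
  have h : repAct m G σ (repCoord i j x) = repCoord i j (σ x) := rfl
  unfold repS
  rw [map_sub, h]
  split_ifs <;> simp

theorem repCoord_mul {m : ℕ} {G : Type*} [Group G] (i j : Fin m) (x y : G) :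
    repCoord i j (x * y) = ∑ h, repCoord i h x * repCoord h j y := by
  apply Subtype.ext
  funext ρ
  simp [repCoord, coordFun, Matrix.mul_apply]

theorem repS_one {m : ℕ} {G : Type*} [Group G] (i j : Fin m) : repS i j (1 : G) = 0 := by
  apply Subtype.ext
  funext ρ
  by_cases h : i = j <;> simp [repS, repCoord, coordFun, h]

theorem repS_mul {m : ℕ} {G : Type*} [Group G] (i j : Fin m) (x y : G) :
    repS i j (x * y) = repS i j x + repS i j y + ∑ h, repS i h x * repS h j y := by
  simp only [repS, repCoord_mul, sub_mul, mul_sub, Finset.sum_sub_distrib]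
  simp
  ring

end RepresentationAlgebra

/-! ### Group actions on the quotients of an invariant ideal -/

section IdealQuotient

/-- `J^k ∩ J` (which is `J^k` for `k ≥ 1`) as a `ℚ`-subspace of the ideal `J`. -/
def powInIdeal {R : Type*} [CommRing R] [Algebra ℚ R] (J : Ideal R) (k : ℕ) : Submodule ℚ J :=
  (Submodule.comap (Submodule.subtype J) (J ^ k)).restrictScalars ℚ

/-- The `ℚ`-vector space `J / J^(k + 1)`. -/
abbrev IdealQuotient {R : Type*} [CommRing R] [Algebra ℚ R] (J : Ideal R) (k : ℕ) : Type _ :=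
  J ⧸ powInIdeal J (k + 1)

/-- The `ℚ`-linear endomorphism of `J` induced by an algebra endomorphism preserving `J`. -/
def idealEnd {R : Type*} [CommRing R] [Algebra ℚ R] (J : Ideal R) (φ : R →ₐ[ℚ] R)
    (hφ : ∀ f ∈ J, φ f ∈ J) : Module.End ℚ J where
  toFun f := ⟨φ f, hφ f f.2⟩
  map_add' f g := Subtype.ext (map_add φ (f : R) (g : R))
  map_smul' q f := Subtype.ext (map_smul φ q (f : R))

theorem idealEnd_mem {R : Type*} [CommRing R] [Algebra ℚ R] (J : Ideal R) (φ : R →ₐ[ℚ] R)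
    (hφ : ∀ f ∈ J, φ f ∈ J) (k : ℕ) :
    powInIdeal J k ≤ (powInIdeal J k).comap (idealEnd J φ hφ) := by
  intro f hf
  have h : (J ^ k).map φ ≤ J ^ k := by
    rw [Ideal.map_pow]
    exact Ideal.pow_right_mono (Ideal.map_le_iff_le_comap.mpr hφ) k
  exact h (Ideal.mem_map_of_mem φ hf)

/-- The homomorphism from a group `A`, acting on `R` by algebra endomorphisms that preserve the
ideal `J`, to the group of `ℚ`-linear automorphisms of `J / J^(k + 1)`. -/
def idealQuotientAct {A R : Type*} [Group A] [CommRing R] [Algebra ℚ R] (J : Ideal R)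
    (act : A →* (R →ₐ[ℚ] R)) (hJ : ∀ a, ∀ f ∈ J, act a f ∈ J) (k : ℕ) :
    A →* LinearMap.GeneralLinearGroup ℚ (IdealQuotient J k) :=
  MonoidHom.toHomUnits
    { toFun := fun a => (powInIdeal J (k + 1)).mapQ (powInIdeal J (k + 1))
        (idealEnd J (act a) (hJ a)) (idealEnd_mem J (act a) (hJ a) (k + 1))
      map_one' := by
        refine LinearMap.ext fun f => ?_
        induction f using Submodule.Quotient.induction_on with
        | H f =>
          refine congrArg Submodule.Quotient.mk (Subtype.ext ?_)
          change act 1 (f : R) = f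
          rw [map_one]
          rfl
      map_mul' := fun a b => by
        refine LinearMap.ext fun f => ?_
        induction f using Submodule.Quotient.induction_on with
        | H f =>
          refine congrArg Submodule.Quotient.mk (Subtype.ext ?_)
          change act (a * b) (f : R) = act a (act b (f : R))
          rw [map_mul]
          rfl }

end IdealQuotient

/-! ### The filtration of `Aut F_n` coming from the representation algebra -/

section FreeGroupFiltration

/-- The ideal `𝔍` of the representation algebra of `F_n` generated by all `s_ij(x_l)`, where
`x_1, …, x_n` is the standard basis of `F_n`. -/
noncomputable def repIdeal (m n : ℕ) : Ideal (repAlgebra m (FreeGroup (Fin n))) :=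
  Ideal.span {f | ∃ (i j : Fin m) (l : Fin n), f = repS i j (FreeGroup.of l)}

theorem repS_mem_repIdeal {m n : ℕ} (x : FreeGroup (Fin n)) :
    ∀ i j : Fin m, repS i j x ∈ repIdeal m n := by
  induction x using FreeGroup.induction_on with
  | C1 => intro i j; rw [repS_one]; exact Ideal.zero_mem _
  | of l => intro i j; exact Ideal.subset_span ⟨i, j, l, rfl⟩
  | inv_of l ih =>
    intro i j
    have h := repS_mul i j (FreeGroup.of l) (FreeGroup.of l)⁻¹
    rw [mul_inv_cancel, repS_one] at h
    have h2 : repS i j (FreeGroup.of l)⁻¹ = -(repS i j (FreeGroup.of l) +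
        ∑ h, repS i h (FreeGroup.of l) * repS h j (FreeGroup.of l)⁻¹) := by
      linear_combination -h
    rw [h2]
    exact neg_mem (add_mem (ih i j)
      (Ideal.sum_mem _ fun h _ => Ideal.mul_mem_right _ _ (ih i h)))
  | mul x y hx hy =>
    intro i j
    rw [repS_mul]
    exact add_mem (add_mem (hx i j) (hy i j))
      (Ideal.sum_mem _ fun h _ => Ideal.mul_mem_right _ _ (hx i h))

theorem repAct_mem_repIdeal {m n : ℕ} (σ : MulAut (FreeGroup (Fin n)))
    (f : repAlgebra m (FreeGroup (Fin n))) (hf : f ∈ repIdeal m n) :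
    repAct m (FreeGroup (Fin n)) σ f ∈ repIdeal m n := by
  have h : repIdeal m n ≤ (repIdeal m n).comap (repAct m (FreeGroup (Fin n)) σ) := by
    refine Ideal.span_le.mpr ?_
    rintro _ ⟨i, j, l, rfl⟩
    change repAct m (FreeGroup (Fin n)) σ (repS i j (FreeGroup.of l)) ∈ repIdeal m n
    rw [repAct_repS]
    exact repS_mem_repIdeal _ i j
  exact h hf

/-- `𝒟^m_{F_n}(k)`, the kernel of `Aut F_n → Aut (𝔍 / 𝔍^(k + 1))`. -/
noncomputable def repFiltration (m n k : ℕ) : Subgroup (MulAut (FreeGroup (Fin n))) :=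
  (idealQuotientAct (repIdeal m n) (repAct m (FreeGroup (Fin n))) repAct_mem_repIdeal k).ker

end FreeGroupFiltration

/-! ### The graded abelian group of the lower central series -/

section GradedLowerCentral

open scoped commutatorElement

variable {G : Type*} [Group G]

/-! Write `y = x⁻¹ * σ x`. Membership of `σ` in the Andreadakis–Johnson term says that every such
`y` lies in `lcs k`, which is `Γ(k + 1)`. Membership in the other filtration gives that all
`s_ij(y)` lie in `𝔍 ^ (k + 1)`. One inclusion holds for all `k`: the universal matrix representation
is congruent to `1` modulo `𝔍`, so it sends `Γ(k + 1)` to matrices congruent to `1` modulo `𝔍 ^ (k +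
1)`.

For the other inclusion, `y` is pushed down the lower central series one step at a time. Suppose `y
∈ Γ(k + 1)` with `k ≤ 3` and all `s_ij(y) ∈ 𝔍 ^ (k + 2)`. Choose a polynomial family of
representations into `SL₂`, embedded as a block in `SL_m`, that is trivial at `X = 0` and sends each
generator `x_a` to `1 + X (p_a e + q_a h + r_a f) + ⋯`. Restriction to the family maps `𝔍` into
`(X)`, so the coefficient of `X ^ (k + 1)` in the image of `y` vanishes. That coefficient is the
value, at these elements of `sl₂`, of the Lie element that `y` defines in degree `k + 1` (`lead`,
`lead_ad`).

It remains to see that a Lie element of degree at most four which vanishes at all points of `sl₂(ℂ)`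
is zero. Basic commutators span each graded piece. On the Borel subalgebra (`r = 0`) the left-normed
ones become independent polynomials while the brackets `⁅⁅a, b⁆, ⁅c, d⁆⁆` vanish
(`eq_zero_of_metabelian_identity`). The remaining brackets in degree four are separated on all of
`sl₂` by polarization (`eq_zero_of_bracket_identity`). -/

theorem Subgroup.commutator_commutator_le_of_rotate {N H₁ H₂ H₃ : Subgroup G} [N.Normal]
    (h₁ : ⁅⁅H₂, H₃⁆, H₁⁆ ≤ N) (h₂ : ⁅⁅H₃, H₁⁆, H₂⁆ ≤ N) : ⁅⁅H₁, H₂⁆, H₃⁆ ≤ N := by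
  have key : ∀ A B C : Subgroup G, ⁅⁅A, B⁆, C⁆ ≤ N ↔
      ⁅⁅A.map (QuotientGroup.mk' N), B.map (QuotientGroup.mk' N)⁆,
        C.map (QuotientGroup.mk' N)⁆ = ⊥ := by
    intro A B C
    rw [← Subgroup.map_commutator, ← Subgroup.map_commutator, Subgroup.map_eq_bot_iff,
      QuotientGroup.ker_mk']
  rw [key] at *
  exact Subgroup.commutator_commutator_eq_bot_of_rotate h₁ h₂

variable (G) in
/-- The lower central series of `G`, numbered from zero. -/
abbrev lcs (k : ℕ) : Subgroup G := (⊤ : Subgroup G).lowerCentralSeries k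

theorem mem_lcs_zero (g : G) : g ∈ lcs G 0 := Subgroup.mem_top g

/-- Induction through the three subgroups lemma. Numbering from zero puts weight `i + 1` at index
`i`, hence the extra `1`. -/
theorem commutator_lcs_le (i j : ℕ) : ⁅lcs G i, lcs G j⁆ ≤ lcs G (i + j + 1) := by
  induction j generalizing i with
  | zero => exact le_rfl
  | succ j ih =>
    rw [Subgroup.commutator_comm]
    change ⁅⁅lcs G j, ⊤⁆, lcs G i⁆ ≤ _
    refine Subgroup.commutator_commutator_le_of_rotate ?_ ?_
    · rw [Subgroup.commutator_comm ⊤]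
      refine (ih (i + 1)).trans (le_of_eq ?_)
      congr 1
      omega
    · exact Subgroup.commutator_mono (ih i) le_rfl

theorem commutator_mem_lcs {i j : ℕ} {g h : G} (hg : g ∈ lcs G i) (hh : h ∈ lcs G j) :
    ⁅g, h⁆ ∈ lcs G (i + j + 1) :=
  commutator_lcs_le i j (Subgroup.commutator_mem_commutator hg hh)

theorem commutator_mem_lcs_succ {k : ℕ} {g : G} (hg : g ∈ lcs G k) (h : G) :
    ⁅g, h⁆ ∈ lcs G (k + 1) :=
  Subgroup.commutator_mem_commutator hg (Subgroup.mem_top h)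

instance lcsQuotientCommGroup (k : ℕ) :
    CommGroup (lcs G k ⧸ (lcs G (k + 1)).subgroupOf (lcs G k)) where
  mul_comm a b := by
    induction a using QuotientGroup.induction_on with | H a => ?_
    induction b using QuotientGroup.induction_on with | H b => ?_
    rw [← QuotientGroup.mk_mul, ← QuotientGroup.mk_mul, QuotientGroup.eq, Subgroup.mem_subgroupOf]
    have h := commutator_mem_lcs_succ ((lcs G k).inv_mem b.2) ((a : G)⁻¹)
    simpa [commutatorElement_def, mul_assoc] using h

variable (G) in
/-- The degree-`k` part `L k / L (k + 1)` of the graded group of the lower central series `L`. -/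
abbrev Gr (k : ℕ) : Type _ := Additive (lcs G k ⧸ (lcs G (k + 1)).subgroupOf (lcs G k))

/-- The class in `Gr G k` of an element of `lcs G k`. -/
def cls {k : ℕ} (g : G) (hg : g ∈ lcs G k) : Gr G k :=
  Additive.ofMul (QuotientGroup.mk ⟨g, hg⟩)

theorem cls_surjective {k : ℕ} (w : Gr G k) : ∃ g hg, cls (k := k) g hg = w := by
  obtain ⟨⟨g, hg⟩, h⟩ := QuotientGroup.mk_surjective w.toMul
  exact ⟨g, hg, congrArg Additive.ofMul h⟩

theorem cls_eq_iff {k : ℕ} {g h : G} (hg : g ∈ lcs G k) (hh : h ∈ lcs G k) :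
    cls g hg = cls h hh ↔ g⁻¹ * h ∈ lcs G (k + 1) :=
  Additive.ofMul.injective.eq_iff.trans (QuotientGroup.eq.trans Subgroup.mem_subgroupOf)

theorem cls_mul {k : ℕ} {g h : G} (hg : g ∈ lcs G k) (hh : h ∈ lcs G k) :
    cls (g * h) (mul_mem hg hh) = cls g hg + cls h hh := rfl

theorem cls_inv {k : ℕ} {g : G} (hg : g ∈ lcs G k) :
    cls g⁻¹ (inv_mem hg) = -cls g hg := rfl

theorem cls_one (k : ℕ) : cls (1 : G) (one_mem (lcs G k)) = 0 := rfl

theorem cls_eq_zero_iff {k : ℕ} {g : G} (hg : g ∈ lcs G k) :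
    cls g hg = 0 ↔ g ∈ lcs G (k + 1) := by
  rw [← cls_one, eq_comm, cls_eq_iff, inv_one, one_mul]

theorem cls_congr {k : ℕ} {g h : G} (e : g = h) (hg : g ∈ lcs G k) :
    cls g hg = cls h (e ▸ hg) := by
  subst e
  rfl

theorem conj_mem_lcs {k : ℕ} (g : G) {z : G} (hz : z ∈ lcs G k) : g * z * g⁻¹ ∈ lcs G k :=
  (inferInstance : (lcs G k).Normal).conj_mem z hz g

theorem cls_conj {k : ℕ} (g : G) {z : G} (hz : z ∈ lcs G k) :
    cls (g * z * g⁻¹) (conj_mem_lcs g hz) = cls z hz := by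
  rw [eq_comm, cls_eq_iff]
  have h := commutator_mem_lcs_succ ((lcs G k).inv_mem hz) g
  simpa [commutatorElement_def, mul_assoc] using h

/-- The additive map `Gr G k → Gr G (k + 1)` induced by `g ↦ ⁅g, h⁆`. -/
def ad (k : ℕ) (h : G) : Gr G k →+ Gr G (k + 1) :=
  MonoidHom.toAdditive (QuotientGroup.lift _
    { toFun := fun g => (cls ⁅(g : G), h⁆ (commutator_mem_lcs_succ g.2 h)).toMul
      map_one' := by
        change (cls ⁅(1 : G), h⁆ _).toMul = _
        rw [cls_congr (commutatorElement_one_left h)]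
        rfl
      map_mul' := fun g g' => by
        have e : ⁅((g * g' : lcs G k) : G), h⁆ = (g : G) * ⁅(g' : G), h⁆ * (g : G)⁻¹ * ⁅(g : G), h⁆ := by
          simp [commutatorElement_def, mul_assoc]
        rw [cls_congr e, cls_mul (conj_mem_lcs _ (commutator_mem_lcs_succ g'.2 h))
          (commutator_mem_lcs_succ g.2 h), cls_conj _ (commutator_mem_lcs_succ g'.2 h),
          add_comm (cls ⁅(g' : G), h⁆ _)]
        rfl }
    (fun g hg => (cls_eq_zero_iff (commutator_mem_lcs_succ g.2 h)).mpr
      (commutator_mem_lcs_succ (Subgroup.mem_subgroupOf.mp hg) h)))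

theorem ad_cls {k : ℕ} (h : G) {g : G} (hg : g ∈ lcs G k) :
    ad k h (cls g hg) = cls ⁅g, h⁆ (commutator_mem_lcs_succ hg h) := rfl

theorem ad_mul {k : ℕ} (h h' : G) (w : Gr G k) : ad k (h * h') w = ad k h w + ad k h' w := by
  obtain ⟨g, hg, rfl⟩ := cls_surjective w
  have e : ⁅g, h * h'⁆ = ⁅g, h⁆ * (h * ⁅g, h'⁆ * h⁻¹) := by
    simp [commutatorElement_def, mul_assoc]
  rw [ad_cls, cls_congr e, cls_mul (commutator_mem_lcs_succ hg h)
    (conj_mem_lcs _ (commutator_mem_lcs_succ hg h')), cls_conj]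
  rfl

theorem ad_one {k : ℕ} (w : Gr G k) : ad k 1 w = 0 := by
  have h := ad_mul 1 1 w
  rw [one_mul] at h
  exact left_eq_add.mp h

theorem ad_inv {k : ℕ} (h : G) (w : Gr G k) : ad k h⁻¹ w = -ad k h w := by
  rw [eq_neg_iff_add_eq_zero, ← ad_mul, inv_mul_cancel, ad_one]

theorem commutator_commutator_mem_lcs {k : ℕ} {g : G} (hg : g ∈ lcs G k) (c d : G) :
    ⁅g, ⁅c, d⁆⁆ ∈ lcs G (k + 1 + 1) :=
  commutator_mem_lcs hg (commutator_mem_lcs_succ (mem_lcs_zero c) d)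

/-- The Jacobi identity of the graded Lie ring, for right-acting brackets. It follows from an exact
group identity once factors deep enough in the series are killed or become central. -/
theorem ad_ad_sub_ad_ad {k : ℕ} {g : G} (hg : g ∈ lcs G k) (c d : G) :
    ad (k + 1) d (ad k c (cls g hg)) - ad (k + 1) c (ad k d (cls g hg)) =
      cls ⁅g, ⁅c, d⁆⁆ (commutator_commutator_mem_lcs hg c d) := by
  set N := lcs G (k + 1 + 1 + 1)
  let π := QuotientGroup.mk' N
  have hA := commutator_mem_lcs_succ hg c
  have hB := commutator_mem_lcs_succ hg d
  have hZ := commutator_commutator_mem_lcs hg c d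
  have central : ∀ z ∈ lcs G (k + 1 + 1), ∀ y : G, π z * π y = π y * π z := by
    intro z hz y
    rw [← commutatorElement_eq_one_iff_mul_comm, ← map_commutatorElement]
    exact (QuotientGroup.eq_one_iff _).mpr (commutator_mem_lcs_succ hz y)
  have hAB : π ⁅g, c⁆ * π ⁅g, d⁆ = π ⁅g, d⁆ * π ⁅g, c⁆ := by
    rw [← commutatorElement_eq_one_iff_mul_comm, ← map_commutatorElement]
    refine (QuotientGroup.eq_one_iff _).mpr ?_
    exact Subgroup.lowerCentralSeries_antitone _ (by omega) (commutator_mem_lcs hA hB)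
  have hq : π ⁅⁅c, d⁆, ⁅g, d * c⁆⁆ = 1 := by
    refine (QuotientGroup.eq_one_iff _).mpr ?_
    have h := commutator_mem_lcs (commutator_mem_lcs_succ (mem_lcs_zero c) d)
      (commutator_mem_lcs_succ hg (d * c))
    exact Subgroup.lowerCentralSeries_antitone _ (by omega) h
  -- Valid in every group. Modulo `N` the factor `⁅⁅c, d⁆, ⁅g, d * c⁆⁆` dies, the double commutators
  -- are central, and `⁅g, c⁆` commutes with `⁅g, d⁆`, so both can be cancelled.
  have e : ⁅g, c⁆ * ⁅c, ⁅g, d⁆⁆ * ⁅g, d⁆ =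
      ⁅g, ⁅c, d⁆⁆ * (⁅⁅c, d⁆, ⁅g, d * c⁆⁆ * (⁅g, d⁆ * ⁅d, ⁅g, c⁆⁆ * ⁅g, c⁆)) := by
    simp [commutatorElement_def, mul_assoc]
  have e' := congrArg π e
  simp only [map_mul, hq, one_mul] at e'
  have hz1 : ⁅c, ⁅g, d⁆⁆ ∈ lcs G (k + 1 + 1) := by
    rw [← commutatorElement_inv]
    exact inv_mem (commutator_mem_lcs_succ hB c)
  have hz2 : ⁅d, ⁅g, c⁆⁆ ∈ lcs G (k + 1 + 1) := by
    rw [← commutatorElement_inv]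
    exact inv_mem (commutator_mem_lcs_succ hA d)
  have e2 : π ⁅c, ⁅g, d⁆⁆ = π (⁅g, ⁅c, d⁆⁆ * ⁅d, ⁅g, c⁆⁆) := by
    rw [map_mul]
    refine mul_right_cancel (b := π ⁅g, d⁆ * π ⁅g, c⁆) ?_
    rw [← hAB, ← mul_assoc, central _ hz1, e', hAB, ← central _ hz2]
    simp only [mul_assoc]
  have e3 : cls ⁅c, ⁅g, d⁆⁆ hz1 = cls ⁅g, ⁅c, d⁆⁆ hZ + cls ⁅d, ⁅g, c⁆⁆ hz2 := by
    rw [← cls_mul, cls_eq_iff]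
    exact QuotientGroup.eq.mp e2
  have n1 : cls ⁅c, ⁅g, d⁆⁆ hz1 = -cls ⁅⁅g, d⁆, c⁆ (commutator_mem_lcs_succ hB c) := by
    rw [← cls_inv, cls_congr (commutatorElement_inv ⁅g, d⁆ c)]
  have n2 : cls ⁅d, ⁅g, c⁆⁆ hz2 = -cls ⁅⁅g, c⁆, d⁆ (commutator_mem_lcs_succ hA d) := by
    rw [← cls_inv, cls_congr (commutatorElement_inv ⁅g, c⁆ d)]
  rw [n1, n2, neg_eq_iff_eq_neg] at e3
  rw [ad_cls, ad_cls, ad_cls, ad_cls, e3]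
  abel

end GradedLowerCentral

/-! ### Hall bases span the graded pieces of weight at most four -/

section HallSpan

open scoped commutatorElement

variable {G : Type*} [Group G] {ι : Type*} (x : ι → G)

/-- The bracket is additive in both arguments, so generators in one weight bracketed with generators
of the group generate the next weight. -/
theorem closure_ad_eq_top {k : ℕ} (hx : Subgroup.closure (Set.range x) = ⊤) {S : Set (Gr G k)}
    (hS : AddSubgroup.closure S = ⊤) :
    AddSubgroup.closure {w | ∃ s ∈ S, ∃ i, w = ad k (x i) s} = ⊤ := by
  set T := AddSubgroup.closure {w | ∃ s ∈ S, ∃ i, w = ad k (x i) s}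
  have h1 : ∀ i, ∀ w, ad k (x i) w ∈ T := by
    intro i w
    have hw : w ∈ AddSubgroup.closure S := hS ▸ AddSubgroup.mem_top w
    induction hw using AddSubgroup.closure_induction with
    | mem s hs => exact AddSubgroup.subset_closure ⟨s, hs, i, rfl⟩
    | zero => rw [map_zero]; exact T.zero_mem
    | add u v _ _ hu hv => rw [map_add]; exact T.add_mem hu hv
    | neg u _ hu => rw [map_neg]; exact T.neg_mem hu
  have h2 : ∀ h : G, ∀ w, ad k h w ∈ T := by
    intro h w
    have hh : h ∈ Subgroup.closure (Set.range x) := hx ▸ Subgroup.mem_top h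
    induction hh using Subgroup.closure_induction with
    | mem s hs => obtain ⟨i, rfl⟩ := hs; exact h1 i w
    | one => rw [ad_one]; exact T.zero_mem
    | mul u v _ _ hu hv => rw [ad_mul]; exact T.add_mem hu hv
    | inv u _ hu => rw [ad_inv]; exact T.neg_mem hu
  rw [eq_top_iff]
  rintro w -
  obtain ⟨g, hg, rfl⟩ := cls_surjective w
  induction hg using Subgroup.closure_induction with
  | mem s hs =>
    obtain ⟨g, hg, h, -, rfl⟩ := hs
    exact h2 h (cls g hg)
  | one => rw [cls_one]; exact T.zero_mem
  | mul u v hu hv hu' hv' => rw [cls_mul hu hv]; exact T.add_mem hu' hv'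
  | inv u hu hu' => rw [cls_inv hu]; exact T.neg_mem hu'

/-- The class of the generator `x a` in weight one. -/
def gen (a : ι) : Gr G 0 := cls (x a) (mem_lcs_zero _)

/-- The class of `⁅x a, x b⁆` in weight two. -/
def comm₂ (a b : ι) : Gr G 1 := ad 0 (x b) (gen x a)

/-- The class of `⁅⁅x a, x b⁆, x c⁆` in weight three. -/
def comm₃ (a b c : ι) : Gr G 2 := ad 1 (x c) (comm₂ x a b)

/-- The class of `⁅⁅⁅x a, x b⁆, x c⁆, x d⁆` in weight four. -/
def comm₄ (a b c d : ι) : Gr G 3 := ad 2 (x d) (comm₃ x a b c)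

/-- The class of `⁅⁅x a, x b⁆, ⁅x c, x d⁆⁆` in weight four. -/
def comm₂₂ (a b c d : ι) : Gr G 3 := comm₄ x a b c d - comm₄ x a b d c

theorem comm₂_self (a : ι) : comm₂ x a a = 0 := by
  rw [comm₂, gen, ad_cls, cls_congr (commutatorElement_self _), cls_one]

theorem comm₂_swap (a b : ι) : comm₂ x b a = -comm₂ x a b := by
  simp only [comm₂, gen, ad_cls]
  rw [cls_congr (commutatorElement_inv (x a) (x b)).symm, cls_inv]

theorem comm₃_self (a c : ι) : comm₃ x a a c = 0 := by
  rw [comm₃, comm₂_self, map_zero]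

theorem comm₃_swap (a b c : ι) : comm₃ x b a c = -comm₃ x a b c := by
  rw [comm₃, comm₂_swap, map_neg, comm₃]

/-- When `c < b < a`, both terms on the right are basic. -/
theorem comm₃_jacobi (a b c : ι) : comm₃ x a b c = comm₃ x a c b - comm₃ x b c a := by
  have h := ad_ad_sub_ad_ad (mem_lcs_zero (x a)) (x b) (x c)
  rw [cls_congr (commutatorElement_inv ⁅x b, x c⁆ (x a)).symm, cls_inv
    (commutator_mem_lcs_succ (commutator_mem_lcs_succ (mem_lcs_zero (x b)) (x c)) (x a))] at h
  exact (sub_eq_iff_eq_add.mp h).trans (neg_add_eq_sub _ _)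

theorem comm₂₂_eq_cls (a b c d : ι) : comm₂₂ x a b c d =
    cls ⁅⁅x a, x b⁆, ⁅x c, x d⁆⁆ (commutator_commutator_mem_lcs
      (commutator_mem_lcs_succ (mem_lcs_zero (x a)) (x b)) (x c) (x d)) :=
  ad_ad_sub_ad_ad (commutator_mem_lcs_succ (mem_lcs_zero (x a)) (x b)) (x c) (x d)

theorem comm₂₂_swap_left (a b c d : ι) : comm₂₂ x b a c d = -comm₂₂ x a b c d := by
  simp only [comm₂₂, comm₄, comm₃_swap x a b, map_neg]
  abel

theorem comm₂₂_swap_right (a b c d : ι) : comm₂₂ x a b d c = -comm₂₂ x a b c d := by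
  simp only [comm₂₂]
  abel

theorem comm₂₂_swap (a b c d : ι) : comm₂₂ x c d a b = -comm₂₂ x a b c d := by
  rw [comm₂₂_eq_cls, comm₂₂_eq_cls, cls_congr
    (commutatorElement_inv ⁅x a, x b⁆ ⁅x c, x d⁆).symm, cls_inv]

theorem comm₂₂_self (a b : ι) : comm₂₂ x a b a b = 0 := by
  rw [comm₂₂_eq_cls, cls_congr (commutatorElement_self _), cls_one]

theorem comm₂₂_self_left (a c d : ι) : comm₂₂ x a a c d = 0 := by
  simp only [comm₂₂, comm₄, comm₃_self, map_zero, sub_zero]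

theorem comm₂₂_self_right (a b c : ι) : comm₂₂ x a b c c = 0 := sub_self _

theorem comm₄_eq (a b c d : ι) : comm₄ x a b c d = comm₄ x a b d c + comm₂₂ x a b c d := by
  simp [comm₂₂]

theorem closure_gen (hx : Subgroup.closure (Set.range x) = ⊤) :
    AddSubgroup.closure (Set.range (gen x)) = ⊤ := by
  rw [eq_top_iff]
  rintro w -
  obtain ⟨g, hg, rfl⟩ := cls_surjective w
  have hh : g ∈ Subgroup.closure (Set.range x) := hx ▸ Subgroup.mem_top g
  induction hh using Subgroup.closure_induction with
  | mem s hs => obtain ⟨i, rfl⟩ := hs; exact AddSubgroup.subset_closure ⟨i, rfl⟩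
  | one => exact zero_mem _
  | mul u v _ _ hu hv => exact add_mem (hu (mem_lcs_zero u)) (hv (mem_lcs_zero v))
  | inv u _ hu => exact neg_mem (hu (mem_lcs_zero u))

variable [LinearOrder ι]

/-- Index set of the basic commutators of weight two. -/
abbrev Basic₂ (ι : Type*) [LinearOrder ι] : Type _ := {t : ι × ι // t.2 < t.1}

/-- Index set of the basic commutators of weight three. -/
abbrev Basic₃ (ι : Type*) [LinearOrder ι] : Type _ :=
  {t : ι × ι × ι // t.2.1 < t.1 ∧ t.2.1 ≤ t.2.2}

/-- Index set of the left-normed basic commutators of weight four. -/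
abbrev Basic₄ (ι : Type*) [LinearOrder ι] : Type _ :=
  {t : ι × ι × ι × ι // t.2.1 < t.1 ∧ t.2.1 ≤ t.2.2.1 ∧ t.2.2.1 ≤ t.2.2.2}

/-- Index set of the basic commutators of weight four of the form `⁅⁅a, b⁆, ⁅c, d⁆⁆`. -/
abbrev Basic₂₂ (ι : Type*) [LinearOrder ι] : Type _ :=
  {t : ι × ι × ι × ι // t.2.1 < t.1 ∧ t.2.2.2 < t.2.2.1 ∧
    (t.2.2.1 < t.1 ∨ t.2.2.1 = t.1 ∧ t.2.2.2 < t.2.1)}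

/-- The basic commutators of weight two. -/
def basic₂ (t : Basic₂ ι) : Gr G 1 := comm₂ x t.1.1 t.1.2

/-- The basic commutators of weight three. -/
def basic₃ (t : Basic₃ ι) : Gr G 2 := comm₃ x t.1.1 t.1.2.1 t.1.2.2

/-- The basic commutators of weight four. -/
def basic₄ : Basic₄ ι ⊕ Basic₂₂ ι → Gr G 3
  | .inl t => comm₄ x t.1.1 t.1.2.1 t.1.2.2.1 t.1.2.2.2
  | .inr t => comm₂₂ x t.1.1 t.1.2.1 t.1.2.2.1 t.1.2.2.2

theorem closure_basic₂ (hx : Subgroup.closure (Set.range x) = ⊤) :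
    AddSubgroup.closure (Set.range (basic₂ x)) = ⊤ := by
  rw [eq_top_iff, ← closure_ad_eq_top x hx (closure_gen x hx), AddSubgroup.closure_le]
  rintro _ ⟨_, ⟨a, rfl⟩, b, rfl⟩
  change comm₂ x a b ∈ AddSubgroup.closure _
  rcases lt_trichotomy b a with h | rfl | h
  · exact AddSubgroup.subset_closure ⟨⟨(a, b), h⟩, rfl⟩
  · rw [comm₂_self]
    exact zero_mem _
  · rw [comm₂_swap x b a]
    exact neg_mem (AddSubgroup.subset_closure ⟨⟨(b, a), h⟩, rfl⟩)

theorem closure_basic₃ (hx : Subgroup.closure (Set.range x) = ⊤) :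
    AddSubgroup.closure (Set.range (basic₃ x)) = ⊤ := by
  have hb : ∀ a b c, b < a → b ≤ c → comm₃ x a b c ∈ AddSubgroup.closure (Set.range (basic₃ x)) :=
    fun a b c h h' => AddSubgroup.subset_closure ⟨⟨(a, b, c), h, h'⟩, rfl⟩
  rw [eq_top_iff, ← closure_ad_eq_top x hx (closure_basic₂ x hx), AddSubgroup.closure_le]
  rintro _ ⟨_, ⟨⟨⟨a, b⟩, hab⟩, rfl⟩, c, rfl⟩
  change comm₃ x a b c ∈ AddSubgroup.closure _
  dsimp only at hab
  rcases le_or_gt b c with h | h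
  · exact hb a b c hab h
  · rw [comm₃_jacobi]
    exact sub_mem (hb _ _ _ (h.trans hab) h.le) (hb _ _ _ h (h.trans hab).le)

theorem comm₂₂_mem_closure (a b c d : ι) :
    comm₂₂ x a b c d ∈ AddSubgroup.closure (Set.range (basic₄ x)) := by
  have hb : ∀ a b c d, b < a → d < c → (c < a ∨ c = a ∧ d < b) →
      comm₂₂ x a b c d ∈ AddSubgroup.closure (Set.range (basic₄ x)) :=
    fun a b c d h h' h'' =>
      AddSubgroup.subset_closure ⟨.inr ⟨(a, b, c, d), h, h', h''⟩, rfl⟩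
  have hb₁ : ∀ a b c d, b < a → d < c →
      comm₂₂ x a b c d ∈ AddSubgroup.closure (Set.range (basic₄ x)) := by
    intro a b c d h h'
    rcases lt_trichotomy c a with hc | rfl | hc
    · exact hb _ _ _ _ h h' (.inl hc)
    · rcases lt_trichotomy d b with hd | rfl | hd
      · exact hb _ _ _ _ h h' (.inr ⟨rfl, hd⟩)
      · rw [comm₂₂_self]
        exact zero_mem _
      · rw [comm₂₂_swap]
        exact neg_mem (hb _ _ _ _ h' h (.inr ⟨rfl, hd⟩))
    · rw [comm₂₂_swap]
      exact neg_mem (hb _ _ _ _ h' h (.inl hc))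
  have hb₂ : ∀ a b c d, b < a →
      comm₂₂ x a b c d ∈ AddSubgroup.closure (Set.range (basic₄ x)) := by
    intro a b c d h
    rcases lt_trichotomy d c with hc | rfl | hc
    · exact hb₁ _ _ _ _ h hc
    · rw [comm₂₂_self_right]
      exact zero_mem _
    · rw [comm₂₂_swap_right]
      exact neg_mem (hb₁ _ _ _ _ h hc)
  rcases lt_trichotomy b a with hc | rfl | hc
  · exact hb₂ _ _ _ _ hc
  · rw [comm₂₂_self_left]
    exact zero_mem _
  · rw [comm₂₂_swap_left]
    exact neg_mem (hb₂ _ _ _ _ hc)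

/-- Exchanging the last two entries costs only a `comm₂₂` term. This sorts them, and also moves a
too small last entry inward, where `comm₃_jacobi` applies. -/
theorem closure_basic₄ (hx : Subgroup.closure (Set.range x) = ⊤) :
    AddSubgroup.closure (Set.range (basic₄ x)) = ⊤ := by
  have hb : ∀ a b c d, b < a → b ≤ c → c ≤ d →
      comm₄ x a b c d ∈ AddSubgroup.closure (Set.range (basic₄ x)) :=
    fun a b c d h h' h'' =>
      AddSubgroup.subset_closure ⟨.inl ⟨(a, b, c, d), h, h', h''⟩, rfl⟩
  have hb' : ∀ a b c d, b < a → b ≤ c → b ≤ d →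
      comm₄ x a b c d ∈ AddSubgroup.closure (Set.range (basic₄ x)) := by
    intro a b c d h h' h''
    rcases le_total c d with hcd | hcd
    · exact hb _ _ _ _ h h' hcd
    · rw [comm₄_eq]
      exact add_mem (hb _ _ _ _ h h'' hcd) (comm₂₂_mem_closure x _ _ _ _)
  rw [eq_top_iff, ← closure_ad_eq_top x hx (closure_basic₃ x hx), AddSubgroup.closure_le]
  rintro _ ⟨_, ⟨⟨⟨a, b, c⟩, hab, hbc⟩, rfl⟩, d, rfl⟩
  change comm₄ x a b c d ∈ AddSubgroup.closure _
  dsimp only at hab hbc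
  rcases le_or_gt b d with h | h
  · exact hb' _ _ _ _ hab hbc h
  · rw [comm₄_eq]
    refine add_mem ?_ (comm₂₂_mem_closure x _ _ _ _)
    rw [comm₄, comm₃_jacobi, map_sub]
    exact sub_mem (hb' _ _ _ _ (h.trans hab) h.le (h.le.trans hbc))
      (hb' _ _ _ _ h (h.trans hab).le (h.le.trans hbc))

end HallSpan

/-! ### Leading coefficients of commutators -/

section LeadingCoefficient

open scoped commutatorElement

/-- `φ ⁅g, h⁆ - 1` is the ring commutator of `φ g - 1` and `φ h - 1` times a unit. The lemma serves
both for powers of `X` and for matrices over powers of `𝔍`. -/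
theorem MonoidHom.sub_one_mem_of_mem_lcs {G S : Type*} [Group G] [Ring S] (φ : G →* S)
    (I : ℕ → AddSubgroup S) (hl : ∀ k s, ∀ a ∈ I k, s * a ∈ I k) (hr : ∀ k s, ∀ a ∈ I k, a * s ∈ I k)
    (hmul : ∀ k, ∀ a ∈ I k, ∀ b ∈ I 1, a * b ∈ I (k + 1) ∧ b * a ∈ I (k + 1))
    (h1 : ∀ g, φ g - 1 ∈ I 1) {k : ℕ} {g : G} (hg : g ∈ lcs G k) : φ g - 1 ∈ I (k + 1) := by
  induction k generalizing g with
  | zero => exact h1 g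
  | succ k ih =>
    induction hg using Subgroup.closure_induction with
    | mem s hs =>
      obtain ⟨g, hg, h, -, rfl⟩ := hs
      have e : φ ⁅g, h⁆ - 1 =
          ((φ g - 1) * (φ h - 1) - (φ h - 1) * (φ g - 1)) * φ (g⁻¹ * h⁻¹) := by
        have e1 : φ (g * h) * φ (g⁻¹ * h⁻¹) = φ ⁅g, h⁆ := by
          rw [← map_mul, commutatorElement_def]
          simp [mul_assoc]
        have e2 : φ (h * g) * φ (g⁻¹ * h⁻¹) = 1 := by
          rw [← map_mul]
          simp [mul_assoc]
        rw [← e1]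
        nth_rewrite 1 [← e2]
        rw [map_mul φ g h, map_mul φ h g]
        noncomm_ring
      rw [e]
      have h2 := hmul (k + 1) _ (ih hg) _ (h1 h)
      exact hr _ _ _ (sub_mem h2.1 h2.2)
    | one => rw [map_one, sub_self]; exact zero_mem _
    | mul u v _ _ hu hv =>
      have e : φ (u * v) - 1 = φ u * (φ v - 1) + (φ u - 1) := by
        rw [map_mul]
        noncomm_ring
      rw [e]
      exact add_mem (hl _ _ _ hv) hu
    | inv u _ hu =>
      have e : φ u⁻¹ - 1 = -(φ u⁻¹ * (φ u - 1)) := by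
        rw [mul_sub, ← map_mul, inv_mul_cancel, map_one, mul_one, neg_sub]
      rw [e]
      exact neg_mem (hl _ _ _ hu)

open Polynomial

theorem Polynomial.X_pow_mul_mul_X_pow_mul {A : Type*} [Ring A] (i j : ℕ) (q r : A[X]) :
    X ^ i * q * (X ^ j * r) = X ^ (i + j) * (q * r) := by
  rw [mul_assoc, ← mul_assoc q, ← X_pow_mul (p := q), pow_add]
  simp only [mul_assoc]

variable {G A : Type*} [Group G] [Ring A] (φ : G →* A[X])

theorem X_pow_dvd_of_mem_lcs (h1 : ∀ g, X ∣ φ g - 1) {k : ℕ} {g : G} (hg : g ∈ lcs G k) :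
    X ^ (k + 1) ∣ φ g - 1 := by
  let I : ℕ → AddSubgroup A[X] := fun k =>
    { carrier := {p | X ^ k ∣ p}
      zero_mem' := dvd_zero _
      add_mem' := dvd_add
      neg_mem' := fun h => (dvd_neg).mpr h }
  refine φ.sub_one_mem_of_mem_lcs I ?_ ?_ ?_ ?_ hg
  · rintro k s _ ⟨q, rfl⟩
    exact ⟨s * q, by rw [← mul_assoc, ← X_pow_mul, mul_assoc]⟩
  · rintro k s _ ⟨q, rfl⟩
    exact ⟨q * s, by rw [mul_assoc]⟩
  · rintro k _ ⟨q, rfl⟩ _ ⟨r, rfl⟩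
    exact ⟨⟨q * r, X_pow_mul_mul_X_pow_mul k 1 q r⟩,
      ⟨r * q, by rw [X_pow_mul_mul_X_pow_mul 1 k r q, add_comm]⟩⟩
  · intro g
    change X ^ 1 ∣ φ g - 1
    rw [pow_one]
    exact h1 g

/-- The additive map `Gr G k → A` sending the class of `g` to the coefficient of `X ^ (k + 1)`
in `φ g - 1`. -/
noncomputable def lead (h1 : ∀ g, X ∣ φ g - 1) (k : ℕ) : Gr G k →+ A :=
  MonoidHom.toAdditiveLeft (QuotientGroup.lift _
    { toFun := fun g => Multiplicative.ofAdd ((φ g - 1).coeff (k + 1))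
      map_one' := by simp
      map_mul' := fun g g' => by
        obtain ⟨q, hq⟩ := X_pow_dvd_of_mem_lcs φ h1 g.2
        obtain ⟨r, hr⟩ := h1 g'
        have e : φ (g * g' : G) - 1 = (φ g - 1) + (φ g' - 1) + X ^ (k + 1) * (X * (q * r)) := by
          have e1 := X_pow_mul_mul_X_pow_mul (k + 1) 1 q r
          rw [pow_one, ← hq, ← hr, pow_succ, mul_assoc] at e1
          rw [← e1, map_mul]
          noncomm_ring
        rw [← ofAdd_add, Subgroup.coe_mul, e, coeff_add, coeff_add, coeff_X_pow_mul']
        simp }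
    (fun g hg => by
      obtain ⟨q, hq⟩ := X_pow_dvd_of_mem_lcs φ h1 (Subgroup.mem_subgroupOf.mp hg)
      change Multiplicative.ofAdd ((φ g - 1).coeff (k + 1)) = 1
      rw [hq, coeff_X_pow_mul']
      simp))

theorem lead_cls (h1 : ∀ g, X ∣ φ g - 1) {k : ℕ} {g : G} (hg : g ∈ lcs G k) :
    lead φ h1 k (cls g hg) = (φ g - 1).coeff (k + 1) := rfl

/-- Compare coefficients in `⁅g, h⁆ * (h * g) = g * h`: up to a term of higher order, `φ ⁅g, h⁆ - 1`
is the ring commutator of `φ g - 1` and `φ h - 1`. Thus `lead` turns group brackets into matrix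
brackets. -/
theorem lead_ad (h1 : ∀ g, X ∣ φ g - 1) {k : ℕ} (h : G) (w : Gr G k) :
    lead φ h1 (k + 1) (ad k h w) =
      lead φ h1 k w * (φ h).coeff 1 - (φ h).coeff 1 * lead φ h1 k w := by
  obtain ⟨g, hg, rfl⟩ := cls_surjective w
  obtain ⟨u, hu⟩ := X_pow_dvd_of_mem_lcs φ h1 (commutator_mem_lcs_succ hg h)
  obtain ⟨q, hq⟩ := X_pow_dvd_of_mem_lcs φ h1 hg
  obtain ⟨r, hr⟩ := h1 h
  obtain ⟨s, hs⟩ := h1 (h * g)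
  have e : φ ⁅g, h⁆ * φ (h * g) = φ (g * h) := by
    rw [← map_mul, commutatorElement_def]
    simp [mul_assoc]
  have e1 : (φ ⁅g, h⁆ - 1) + (φ ⁅g, h⁆ - 1) * (φ (h * g) - 1) =
      (φ g - 1) * (φ h - 1) - (φ h - 1) * (φ g - 1) := by
    have : φ ⁅g, h⁆ * φ (h * g) - φ (h * g) = φ g * φ h - φ h * φ g := by
      rw [e, map_mul, map_mul]
    calc _ = φ ⁅g, h⁆ * φ (h * g) - φ (h * g) := by noncomm_ring
      _ = _ := by rw [this]; noncomm_ring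
  have c1 : (φ h).coeff 1 = r.coeff 0 := by
    have : φ h = 1 + X * r := by rw [← hr]; abel
    rw [this, coeff_add, coeff_one]
    simp
  rw [ad_cls, lead_cls, lead_cls, c1]
  have e2 : (φ g - 1) * (φ h - 1) - (φ h - 1) * (φ g - 1) =
      X ^ (k + 1 + 1) * (q * r - r * q) := by
    have h₁ := X_pow_mul_mul_X_pow_mul (k + 1) 1 q r
    have h₂ := X_pow_mul_mul_X_pow_mul 1 (k + 1) r q
    rw [pow_one] at h₁ h₂
    rw [hq, hr, h₁, h₂, add_comm 1, mul_sub]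
  have e3 : (φ ⁅g, h⁆ - 1) * (φ (h * g) - 1) = X ^ (k + 1 + 1) * (X * (u * s)) := by
    have h₁ := X_pow_mul_mul_X_pow_mul (k + 1 + 1) 1 u s
    rw [pow_one] at h₁
    rw [hu, hs, h₁, pow_succ, mul_assoc]
  rw [e2, e3] at e1
  have e4 := congrArg (fun p => p.coeff (k + 1 + 1)) e1
  rw [hu] at e4 ⊢
  rw [hq]
  simp only [coeff_add, coeff_X_pow_mul', le_refl, if_true, Nat.sub_self] at e4 ⊢
  simpa using e4

end LeadingCoefficient

/-! ### Linear independence of basic commutators on `sl₂` -/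

section Independence

variable {α : Type*} [LinearOrder α]

theorem eq_zero_of_metabelian_identity {ι : Type*} [Fintype ι] (a b : ι → α) (s : ι → α →₀ ℕ)
    (hab : ∀ i, b i < a i) (hs : ∀ i j, s i j ≠ 0 → b i ≤ j)
    (hinj : ∀ i j, a i = a j → Finsupp.single (b i) 1 + s i = Finsupp.single (b j) 1 + s j → i = j)
    (c : ι → ℂ) (h : ∀ q p : α → ℂ, ∑ i, c i * ((q (a i) * p (b i) - q (b i) * p (a i)) *
      (s i).prod fun j e => q j ^ e) = 0) : c = 0 := by
  classical
  funext i₀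
  -- The left side of `h` at `p = Pi.single (a i₀) 1`, as a polynomial in `q`. The coefficient at
  -- the monomial of `q (b i₀)` times the `s i₀` part isolates `c i₀`.
  let P : MvPolynomial α ℂ := ∑ i,
    ((if b i = a i₀ then MvPolynomial.monomial (Finsupp.single (a i) 1 + s i) (c i) else 0) -
      (if a i = a i₀ then MvPolynomial.monomial (Finsupp.single (b i) 1 + s i) (c i) else 0))
  have hP : P = 0 := by
    refine MvPolynomial.funext fun q => ?_
    rw [map_zero, ← h q (Pi.single (a i₀) 1), map_sum]
    refine Finset.sum_congr rfl fun i _ => ?_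
    have hprod : ∀ l, (Finsupp.single l 1 + s i).prod (fun j e => q j ^ e) =
        q l * (s i).prod fun j e => q j ^ e := by
      intro l
      rw [Finsupp.prod_add_index' (by simp) (by intros; rw [pow_add]),
        Finsupp.prod_single_index (by simp), pow_one]
    rw [map_sub, apply_ite (MvPolynomial.eval q), apply_ite (MvPolynomial.eval q), map_zero,
      MvPolynomial.eval_monomial, MvPolynomial.eval_monomial, hprod, hprod, Pi.single_apply,
      Pi.single_apply]
    split_ifs <;> ring
  have hc := congrArg (MvPolynomial.coeff (Finsupp.single (b i₀) 1 + s i₀)) hP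
  rw [MvPolynomial.coeff_zero, MvPolynomial.coeff_sum, Finset.sum_eq_single i₀] at hc
  · rw [if_neg (hab i₀).ne, if_pos rfl] at hc
    simpa using hc
  · intro i _ hi
    rw [MvPolynomial.coeff_sub, apply_ite (MvPolynomial.coeff _), apply_ite (MvPolynomial.coeff _),
      MvPolynomial.coeff_zero, MvPolynomial.coeff_monomial, MvPolynomial.coeff_monomial]
    -- All variables of the left monomial have index at least `b i = a i₀ > b i₀`, so `b i₀` cannot
    -- occur in it.
    have h₁ : b i = a i₀ → Finsupp.single (a i) 1 + s i ≠ Finsupp.single (b i₀) 1 + s i₀ := by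
      intro hb he
      have he' := DFunLike.congr_fun he (b i₀)
      rw [Finsupp.add_apply, Finsupp.add_apply, Finsupp.single_eq_same,
        Finsupp.single_eq_of_ne (by
          have := hab i
          have := hab i₀
          rw [hb] at *
          exact (‹b i₀ < a i₀›.trans ‹a i₀ < a i›).ne)] at he'
      have := hs i (b i₀) (by omega)
      rw [hb] at this
      exact this.not_gt (hab i₀)
    have h₂ : a i = a i₀ → Finsupp.single (b i) 1 + s i ≠ Finsupp.single (b i₀) 1 + s i₀ :=
      fun ha he => hi (hinj _ _ ha he)
    split_ifs <;> simp_all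
  · intro h
    exact absurd (Finset.mem_univ _) h

theorem Pi.single_mul_single_eq_zero {i j k l : α} (h : ¬(j = i ∧ l = k)) :
    (Pi.single i 1 : α → ℂ) j * (Pi.single k 1 : α → ℂ) l = 0 := by
  rw [Pi.single_apply, Pi.single_apply]
  split_ifs <;> simp_all

/-- Polarizing in `p` gives a form `f p q p' r` on two pairs, alternating in each pair and changing
sign when the pairs are exchanged. Vanishing at `p = p'` makes it alternate in all four arguments.
Exchanging the pairs is an even permutation, so `f` equals its own negative. -/
theorem eq_zero_of_bracket_identity [Fintype α] (e : Basic₂₂ α → ℂ)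
    (h : ∀ p q r : α → ℂ, ∑ t : Basic₂₂ α, e t *
      ((p t.1.1 * q t.1.2.1 - p t.1.2.1 * q t.1.1) *
          (p t.1.2.2.1 * r t.1.2.2.2 - p t.1.2.2.2 * r t.1.2.2.1) -
        (p t.1.1 * r t.1.2.1 - p t.1.2.1 * r t.1.1) *
          (p t.1.2.2.1 * q t.1.2.2.2 - p t.1.2.2.2 * q t.1.2.2.1)) = 0) : e = 0 := by
  classical
  let f : (p q p' r : α → ℂ) → ℂ := fun p q p' r => ∑ t : Basic₂₂ α, e t *
      ((p t.1.1 * q t.1.2.1 - p t.1.2.1 * q t.1.1) *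
          (p' t.1.2.2.1 * r t.1.2.2.2 - p' t.1.2.2.2 * r t.1.2.2.1) -
        (p' t.1.1 * r t.1.2.1 - p' t.1.2.1 * r t.1.1) *
          (p t.1.2.2.1 * q t.1.2.2.2 - p t.1.2.2.2 * q t.1.2.2.1))
  have swap_left : ∀ p q p' r, f q p p' r = -f p q p' r := fun p q p' r => by
    rw [← Finset.sum_neg_distrib]
    exact Finset.sum_congr rfl fun t _ => by ring
  have swap_right : ∀ p q p' r, f p q r p' = -f p q p' r := fun p q p' r => by
    rw [← Finset.sum_neg_distrib]
    exact Finset.sum_congr rfl fun t _ => by ring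
  have swap : ∀ p q p' r, f p' r p q = -f p q p' r := fun p q p' r => by
    rw [← Finset.sum_neg_distrib]
    exact Finset.sum_congr rfl fun t _ => by ring
  have add : ∀ p q p' r, f (p + p') q (p + p') r =
      f p q p r + f p' q p' r + (f p q p' r + f p' q p r) := fun p q p' r => by
    simp only [f, ← Finset.sum_add_distrib, Pi.add_apply]
    exact Finset.sum_congr rfl fun t _ => by ring
  have diag : ∀ p q r, f p q p r = 0 := h
  have swap_outer : ∀ p q p' r, f p' q p r = -f p q p' r := fun p q p' r => by
    have := add p q p' r
    rw [diag, diag, diag] at this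
    linear_combination -this
  have zero : ∀ p q p' r, f p q p' r = 0 := fun p q p' r => by
    linear_combination (swap_right p q r p' - swap_left q p r p' + swap_outer r p q p' -
      swap_right r p p' q + swap_left p r p' q - swap_outer p r p' q + swap p q p' r) / 2
  funext t₀
  obtain ⟨⟨a, b, c, d⟩, h₁, h₂, h₃⟩ := t₀
  -- Unit vectors at the four indices isolate the coefficient of `t₀`: the orderings in `Basic₂₂`
  -- exclude every other term.
  have h₄ := zero (Pi.single a 1) (Pi.single b 1) (Pi.single c 1) (Pi.single d 1)
  dsimp only [f] at h₄ h₁ h₂ h₃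
  rw [Finset.sum_eq_single ⟨(a, b, c, d), h₁, h₂, h₃⟩] at h₄
  · dsimp only at h₄
    have z₁ := Pi.single_mul_single_eq_zero (i := c) (j := b) (k := d) (l := a) fun h => by
      obtain ⟨rfl, rfl⟩ := h
      exact h₁.not_gt h₂
    simp only [Pi.single_eq_same, Pi.single_eq_of_ne h₁.ne, Pi.single_eq_of_ne h₁.ne',
      Pi.single_eq_of_ne h₂.ne, Pi.single_eq_of_ne h₂.ne', z₁] at h₄
    rcases h₃ with h₃ | ⟨rfl, h₃⟩
    · simpa [Pi.single_eq_of_ne h₃.ne, Pi.single_eq_of_ne h₃.ne'] using h₄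
    · simpa [Pi.single_eq_of_ne h₃.ne, Pi.single_eq_of_ne h₃.ne'] using h₄
  · rintro ⟨⟨a', b', c', d'⟩, k₁, k₂, k₃⟩ - hne
    dsimp only at k₁ k₂ k₃ ⊢
    have z₁ := Pi.single_mul_single_eq_zero (i := a) (j := b') (k := b) (l := a') fun h => by
      obtain ⟨rfl, rfl⟩ := h
      exact h₁.not_gt k₁
    have z₂ := Pi.single_mul_single_eq_zero (i := c) (j := d') (k := d) (l := c') fun h => by
      obtain ⟨rfl, rfl⟩ := h
      exact h₂.not_gt k₂
    have z₃ := Pi.single_mul_single_eq_zero (i := c) (j := b') (k := d) (l := a') fun h => by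
      obtain ⟨rfl, rfl⟩ := h
      exact h₂.not_gt k₁
    have z₄ := Pi.single_mul_single_eq_zero (i := a) (j := d') (k := b) (l := c') fun h => by
      obtain ⟨rfl, rfl⟩ := h
      exact h₁.not_gt k₂
    rw [z₁, z₂, z₃, z₄, sub_zero, sub_zero, sub_zero, sub_zero]
    have z₅ : (Pi.single a 1 : α → ℂ) a' * (Pi.single b 1 : α → ℂ) b' *
        ((Pi.single c 1 : α → ℂ) c' * (Pi.single d 1 : α → ℂ) d') = 0 := by
      by_cases h : a' = a ∧ b' = b
      · obtain ⟨rfl, rfl⟩ := h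
        rw [Pi.single_mul_single_eq_zero (i := c), mul_zero]
        rintro ⟨rfl, rfl⟩
        exact hne rfl
      · rw [Pi.single_mul_single_eq_zero h, zero_mul]
    have z₆ : (Pi.single c 1 : α → ℂ) a' * (Pi.single d 1 : α → ℂ) b' *
        ((Pi.single a 1 : α → ℂ) c' * (Pi.single b 1 : α → ℂ) d') = 0 := by
      by_cases h : a' = c ∧ b' = d
      · obtain ⟨rfl, rfl⟩ := h
        rw [Pi.single_mul_single_eq_zero (i := a), mul_zero]
        rintro ⟨rfl, rfl⟩
        rcases h₃ with h₃ | ⟨rfl, h₃⟩ <;> rcases k₃ with k₃ | ⟨k, k₃⟩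
        · exact h₃.not_gt k₃
        · exact h₃.ne' k
        · exact k₃.ne rfl
        · exact h₃.not_gt k₃
      · rw [Pi.single_mul_single_eq_zero h, zero_mul]
    rw [z₅, z₆, sub_zero, mul_zero]
  · intro h
    exact absurd (Finset.mem_univ _) h

end Independence

/-! ### Evaluation on `sl₂` detects the graded pieces of weight at most four -/

section Detection

theorem exists_eq_sum_of_closure_eq_top {M κ : Type*} [AddCommGroup M] [Fintype κ] {v : κ → M}
    (hv : AddSubgroup.closure (Set.range v) = ⊤) (w : M) : ∃ c : κ → ℤ, w = ∑ i, c i • v i := by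
  have hw : w ∈ Submodule.span ℤ (Set.range v) := by
    rw [← Submodule.mem_toAddSubgroup, Submodule.span_int_eq_addSubgroupClosure, hv]
    trivial
  obtain ⟨c, hc⟩ := (Submodule.mem_span_range_iff_exists_fun ℤ).mp hw
  exact ⟨c, hc.symm⟩

/-- The matrix `p e + q h + r f` of `sl₂`. -/
def slMat (p q r : ℂ) : Matrix (Fin 2) (Fin 2) ℂ := !![q, p; r, -q]

theorem bracket_slMat (p q r p' q' r' : ℂ) :
    slMat p q r * slMat p' q' r' - slMat p' q' r' * slMat p q r =
      slMat (-2 * (p * q' - p' * q)) (p * r' - p' * r) (-2 * (q * r' - q' * r)) := by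
  ext i j
  fin_cases i <;> fin_cases j <;> simp [slMat] <;> ring

variable {G : Type*} [Group G] {ι : Type*} (x : ι → G)

/-- A family of additive maps on the graded pieces that behaves like the evaluation of Lie
elements at `x a ↦ p a • e + q a • h + r a • f`. -/
structure IsSlEvaluation (p q r : ι → ℂ) (lam : ∀ k, Gr G k →+ Matrix (Fin 2) (Fin 2) ℂ) :
    Prop where
  gen : ∀ a, lam 0 (gen x a) = slMat (p a) (q a) (r a)
  ad : ∀ k a w, lam (k + 1) (ad k (x a) w) =
    lam k w * slMat (p a) (q a) (r a) - slMat (p a) (q a) (r a) * lam k w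

namespace IsSlEvaluation

variable {x} {p q r : ι → ℂ} {lam : ∀ k, Gr G k →+ Matrix (Fin 2) (Fin 2) ℂ}
  (h : IsSlEvaluation x p q r lam)
include h

theorem comm₂ (a b : ι) : lam 1 (comm₂ x a b) = slMat (-2 * (p a * q b - p b * q a))
    (p a * r b - p b * r a) (-2 * (q a * r b - q b * r a)) := by
  rw [_root_.comm₂, h.ad, h.gen, bracket_slMat]

theorem comm₂₂ (a b c d : ι) : lam 3 (comm₂₂ x a b c d) 0 1 =
    4 * ((p a * q b - p b * q a) * (p c * r d - p d * r c) -
      (p a * r b - p b * r a) * (p c * q d - p d * q c)) := by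
  rw [_root_.comm₂₂, map_sub, comm₄, comm₄, comm₃, comm₃, h.ad, h.ad, h.ad, h.ad, h.comm₂,
    bracket_slMat, bracket_slMat, bracket_slMat, bracket_slMat]
  simp [slMat]
  ring

theorem comm₂_borel (hr : r = 0) (a b : ι) :
    lam 1 (_root_.comm₂ x a b) = slMat (2 * (q a * p b - q b * p a)) 0 0 := by
  rw [h.comm₂, hr]
  congr 1
  · ring
  · simp
  · simp

theorem comm₃_borel (hr : r = 0) (a b c : ι) :
    lam 2 (comm₃ x a b c) = slMat (-4 * ((q a * p b - q b * p a) * q c)) 0 0 := by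
  rw [comm₃, h.ad, h.comm₂_borel hr, bracket_slMat, hr]
  congr 1 <;> simp
  ring

theorem comm₄_borel (hr : r = 0) (a b c d : ι) :
    lam 3 (comm₄ x a b c d) = slMat (8 * ((q a * p b - q b * p a) * (q c * q d))) 0 0 := by
  rw [comm₄, h.ad, h.comm₃_borel hr, bracket_slMat, hr]
  congr 1 <;> simp
  ring

end IsSlEvaluation

variable [LinearOrder ι]

/-- A monomial determines its sorted list of indices; this supplies the injectivity needed in
`eq_zero_of_metabelian_identity`. -/
theorem sorted_pair_eq {b c b' c' : ι} (h : b ≤ c) (h' : b' ≤ c')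
    (e : Finsupp.single b 1 + Finsupp.single c 1 = (Finsupp.single b' 1 + Finsupp.single c' 1 : ι →₀ ℕ)) :
    b = b' ∧ c = c' := by
  have e' := congrArg Finsupp.toMultiset e
  simp only [map_add, Finsupp.toMultiset_single, one_smul] at e'
  have hl : ([b, c] : List ι).Perm [b', c'] := Multiset.coe_eq_coe.mp e'
  have := hl.eq_of_pairwise' (r := (· ≤ ·)) (by simpa using h) (by simpa using h')
  simpa using this

theorem sorted_triple_eq {b c d b' c' d' : ι} (h : b ≤ c) (h₁ : c ≤ d) (h' : b' ≤ c')
    (h₁' : c' ≤ d')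
    (e : Finsupp.single b 1 + (Finsupp.single c 1 + Finsupp.single d 1) =
      (Finsupp.single b' 1 + (Finsupp.single c' 1 + Finsupp.single d' 1) : ι →₀ ℕ)) :
    b = b' ∧ c = c' ∧ d = d' := by
  have e' := congrArg Finsupp.toMultiset e
  simp only [map_add, Finsupp.toMultiset_single, one_smul] at e'
  have hl : ([b, c, d] : List ι).Perm [b', c', d'] := Multiset.coe_eq_coe.mp e'
  have := hl.eq_of_pairwise' (r := (· ≤ ·)) (by simpa using ⟨⟨h, h.trans h₁⟩, h₁⟩)
    (by simpa using ⟨⟨h', h'.trans h₁'⟩, h₁'⟩)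
  simpa using this

variable [Fintype ι] {x} {lam : (p q r : ι → ℂ) → ∀ k, Gr G k →+ Matrix (Fin 2) (Fin 2) ℂ}
  (hlam : ∀ p q r, IsSlEvaluation x p q r (lam p q r))
  (hx : Subgroup.closure (Set.range x) = ⊤)
include hlam hx

theorem eq_zero_of_evaluation_zero (w : Gr G 0) (hw : ∀ p q r, lam p q r 0 w = 0) : w = 0 := by
  obtain ⟨c, rfl⟩ := exists_eq_sum_of_closure_eq_top (closure_gen x hx) w
  refine Finset.sum_eq_zero fun a _ => ?_
  have h := congrFun₂ (hw (Pi.single a 1) 0 0) 0 1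
  simp only [map_sum, map_zsmul, (hlam _ _ _).gen, Matrix.sum_apply] at h
  rw [Finset.sum_eq_single a] at h
  · simp [slMat] at h
    rw [h, zero_smul]
  · intro b _ hb
    simp [slMat, hb]
  · simp

/-- In weights two and three all basic commutators are left-normed, so the Borel subalgebra `r = 0`
already separates them. -/
theorem eq_zero_of_evaluation_one (w : Gr G 1) (hw : ∀ p q r, lam p q r 1 w = 0) : w = 0 := by
  obtain ⟨c, rfl⟩ := exists_eq_sum_of_closure_eq_top (closure_basic₂ x hx) w
  have hc := eq_zero_of_metabelian_identity (fun t : Basic₂ ι => t.1.1) (fun t => t.1.2)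
    (fun _ => 0) (fun t => t.2) (by simp) (by
      rintro ⟨⟨a, b⟩, _⟩ ⟨⟨a', b'⟩, _⟩ h h'
      simp only [add_zero] at h h'
      have := Finsupp.single_left_injective one_ne_zero h'
      simp_all) (fun t => c t) (by
      intro q p
      have h := congrFun₂ (hw p q 0) 0 1
      simp only [map_sum, map_zsmul, basic₂, (hlam _ _ _).comm₂_borel rfl, Matrix.sum_apply,
        Matrix.smul_apply] at h
      rw [← mul_right_inj' (two_ne_zero' ℂ), Finset.mul_sum, mul_zero]
      refine Eq.trans (Finset.sum_congr rfl fun t _ => ?_) h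
      simp [slMat]
      ring)
  refine Finset.sum_eq_zero fun t _ => ?_
  have ht := congrFun hc t
  simp only [Pi.zero_apply, Int.cast_eq_zero] at ht
  rw [ht, zero_smul]

theorem eq_zero_of_evaluation_two (w : Gr G 2) (hw : ∀ p q r, lam p q r 2 w = 0) : w = 0 := by
  obtain ⟨c, rfl⟩ := exists_eq_sum_of_closure_eq_top (closure_basic₃ x hx) w
  have hc := eq_zero_of_metabelian_identity (fun t : Basic₃ ι => t.1.1) (fun t => t.1.2.1)
    (fun t => Finsupp.single t.1.2.2 1) (fun t => t.2.1) (by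
      rintro ⟨⟨a, b, c⟩, h, h'⟩ j hj
      rw [Finsupp.single_apply] at hj
      obtain rfl : c = j := by simpa using hj
      exact h') (by
      rintro ⟨⟨a, b, c⟩, h, h'⟩ ⟨⟨a', b', c'⟩, k, k'⟩ e e'
      have := sorted_pair_eq h' k' e'
      simp_all) (fun t => c t) (by
      intro q p
      have h := congrFun₂ (hw p q 0) 0 1
      simp only [map_sum, map_zsmul, basic₃, (hlam _ _ _).comm₃_borel rfl, Matrix.sum_apply,
        Matrix.smul_apply] at h
      rw [← mul_right_inj' (show (-4 : ℂ) ≠ 0 by norm_num), Finset.mul_sum, mul_zero]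
      refine Eq.trans (Finset.sum_congr rfl fun t _ => ?_) h
      simp [slMat]
      ring)
  refine Finset.sum_eq_zero fun t _ => ?_
  have ht := congrFun hc t
  simp only [Pi.zero_apply, Int.cast_eq_zero] at ht
  rw [ht, zero_smul]

theorem eq_zero_of_evaluation_three (w : Gr G 3) (hw : ∀ p q r, lam p q r 3 w = 0) : w = 0 := by
  obtain ⟨c, rfl⟩ := exists_eq_sum_of_closure_eq_top (closure_basic₄ x hx) w
  rw [Fintype.sum_sum_type] at hw ⊢
  have hc := eq_zero_of_metabelian_identity (fun t : Basic₄ ι => t.1.1) (fun t => t.1.2.1)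
    (fun t => Finsupp.single t.1.2.2.1 1 + Finsupp.single t.1.2.2.2 1) (fun t => t.2.1) (by
      rintro ⟨⟨a, b, c, d⟩, h, h', h''⟩ j hj
      rw [Finsupp.add_apply, Finsupp.single_apply, Finsupp.single_apply] at hj
      dsimp only at hj h h' h'' ⊢
      split_ifs at hj with h₁ h₂ h₂
      · exact h₁ ▸ h'
      · exact h₁ ▸ h'
      · exact h₂ ▸ h'.trans h''
      · exact absurd rfl hj) (by
      rintro ⟨⟨a, b, c, d⟩, h, h', h''⟩ ⟨⟨a', b', c', d'⟩, k, k', k''⟩ e e'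
      have := sorted_triple_eq h' h'' k' k'' e'
      simp_all) (fun t => c (.inl t)) (by
      intro q p
      have h := congrFun₂ (hw p q 0) 0 1
      simp only [map_add, map_sum, map_zsmul, basic₄, (hlam _ _ _).comm₄_borel rfl,
        Matrix.sum_apply, Matrix.smul_apply, Matrix.add_apply, (hlam _ _ _).comm₂₂] at h
      rw [← mul_right_inj' (show (8 : ℂ) ≠ 0 by norm_num), Finset.mul_sum, mul_zero]
      refine Eq.trans ?_ h
      -- The derived algebra of the Borel subalgebra is abelian, so every `comm₂₂` evaluates to
      -- zero.
      rw [Finset.sum_eq_zero (s := (Finset.univ : Finset (Basic₂₂ ι))) (by simp), add_zero]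
      refine Finset.sum_congr rfl fun t _ => ?_
      rw [Finsupp.prod_add_index' (by simp) (by intros; rw [pow_add]),
        Finsupp.prod_single_index (by simp), Finsupp.prod_single_index (by simp)]
      simp [slMat]
      ring)
  have hc' : ∀ t, c (.inl t) = 0 := fun t => by simpa using congrFun hc t
  simp only [hc', zero_smul, Finset.sum_const_zero, zero_add] at hw ⊢
  have he := eq_zero_of_bracket_identity (fun t : Basic₂₂ ι => (c (.inr t) : ℂ)) (by
    intro p q r
    have h := congrFun₂ (hw p q r) 0 1
    simp only [map_sum, map_zsmul, basic₄, Matrix.sum_apply, Matrix.smul_apply,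
      (hlam _ _ _).comm₂₂] at h
    rw [← mul_right_inj' (show (4 : ℂ) ≠ 0 by norm_num), Finset.mul_sum, mul_zero]
    refine Eq.trans (Finset.sum_congr rfl fun t _ => ?_) h
    rw [zsmul_eq_mul]
    ring)
  refine Finset.sum_eq_zero fun t _ => ?_
  have ht := congrFun he t
  simp only [Pi.zero_apply, Int.cast_eq_zero] at ht
  rw [ht, zero_smul]

end Detection

/-! ### Families of representations near the trivial one -/

section Families

open Polynomial Matrix

/-- The block matrix with diagonal blocks `A` and `1`. -/
def blockMat (l : ℕ) {B : Type*} [CommRing B] (A : Matrix (Fin 2) (Fin 2) B) :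
    Matrix (Fin (2 + l)) (Fin (2 + l)) B :=
  Matrix.reindex finSumFinEquiv finSumFinEquiv
    (Matrix.fromBlocks A 0 0 1 : Matrix (Fin 2 ⊕ Fin l) (Fin 2 ⊕ Fin l) B)

theorem blockMat_one (l : ℕ) {B : Type*} [CommRing B] :
    blockMat l (1 : Matrix (Fin 2) (Fin 2) B) = 1 := by
  simp [blockMat]

theorem blockMat_mul (l : ℕ) {B : Type*} [CommRing B] (A A' : Matrix (Fin 2) (Fin 2) B) :
    blockMat l (A * A') = blockMat l A * blockMat l A' := by
  simp [blockMat, Matrix.submatrix_mul_equiv, Matrix.fromBlocks_multiply]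

theorem blockMat_apply_castAdd (l : ℕ) {B : Type*} [CommRing B] (A : Matrix (Fin 2) (Fin 2) B)
    (i j : Fin 2) : blockMat l A (Fin.castAdd l i) (Fin.castAdd l j) = A i j := by
  simp [blockMat]

theorem blockMat_sub_one_mem {l : ℕ} {B : Type*} [CommRing B] {A : Matrix (Fin 2) (Fin 2) B}
    {I : Ideal B} (h : ∀ i j, A i j - (1 : Matrix (Fin 2) (Fin 2) B) i j ∈ I) (i j : Fin (2 + l)) :
    blockMat l A i j - (1 : Matrix _ _ B) i j ∈ I := by
  rw [← blockMat_one]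
  obtain ⟨i, rfl⟩ := finSumFinEquiv.surjective i
  obtain ⟨j, rfl⟩ := finSumFinEquiv.surjective j
  simp only [blockMat, Matrix.reindex_apply, Matrix.submatrix_apply, Equiv.symm_apply_apply]
  rcases i with i | i <;> rcases j with j | j
  · exact h i j
  all_goals simp only [Matrix.fromBlocks_apply₁₂, Matrix.fromBlocks_apply₂₁,
    Matrix.fromBlocks_apply₂₂, sub_self, I.zero_mem]

/-- The block embedding `SL₂ → SL_{2 + l}`. -/
def blockSL (l : ℕ) (B : Type*) [CommRing B] :
    SpecialLinearGroup (Fin 2) B →* SpecialLinearGroup (Fin (2 + l)) B where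
  toFun A := ⟨blockMat l A, by
    rw [blockMat, Matrix.det_reindex_self, Matrix.det_fromBlocks_zero₂₁, A.det_coe, Matrix.det_one,
      one_mul]⟩
  map_one' := Subtype.ext (blockMat_one l)
  map_mul' A A' := Subtype.ext (blockMat_mul l (A : Matrix _ _ B) (A' : Matrix _ _ B))

/-- Pull functions back along the curve `z ↦ ρ_z`. On the generators the result is a polynomial
function of `z`, hence on the whole algebra, and a complex polynomial is determined by its values.
No relations between the `a_ij(x)` need to be known. -/
theorem exists_ringHom_repCoord {m : ℕ} {G : Type*} [Group G]
    (ρ : G →* SpecialLinearGroup (Fin m) ℂ[X]) :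
    ∃ Θ : repAlgebra m G →+* ℂ[X], ∀ i j x, Θ (repCoord i j x) = (ρ x : Matrix _ _ ℂ[X]) i j := by
  let ψ : ℂ[X] →+* (ℂ → ℂ) := RingHom.pi fun z => evalRingHom z
  have hψ : Function.Injective ψ := fun P Q h => Polynomial.funext fun z => congrFun h z
  let Φ : repAlgebra m G →+* (ℂ → ℂ) := RingHom.pi fun z =>
    (Pi.evalRingHom (fun _ => ℂ) ((SpecialLinearGroup.map (evalRingHom z)).comp ρ)).comp
      (repAlgebra m G).val.toRingHom
  have hΦ : ∀ i j x, Φ (repCoord i j x) = ψ ((ρ x : Matrix _ _ ℂ[X]) i j) := fun i j x => rfl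
  have hmem : ∀ f, Φ f ∈ ψ.range := by
    rintro ⟨f, hf⟩
    induction hf using Algebra.adjoin_induction with
    | mem f hf =>
      obtain ⟨i, j, x, rfl⟩ := hf
      exact ⟨_, (hΦ i j x).symm⟩
    | algebraMap q => exact ⟨C (q : ℂ), funext fun z => eval_C⟩
    | add f g hf hg hf' hg' => exact add_mem hf' hg'
    | mul f g hf hg hf' hg' => exact mul_mem hf' hg'
  let e : ℂ[X] ≃+* ψ.range := RingEquiv.ofBijective ψ.rangeRestrict
    ⟨fun P Q h => hψ (congrArg Subtype.val h), ψ.rangeRestrict_surjective⟩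
  refine ⟨e.symm.toRingHom.comp (Φ.codRestrict ψ.range hmem), fun i j x => ?_⟩
  change e.symm _ = _
  rw [RingEquiv.symm_apply_eq]
  exact Subtype.ext (hΦ i j x)

/-- A polynomial path in `SL₂` through the identity with velocity `p e + q h + r f`. -/
noncomputable def slPath (p q r : ℂ) : SpecialLinearGroup (Fin 2) ℂ[X] :=
  -- The product of `1 + q X (h - e + f)`, `1 + (p + q) X e` and `1 + (r - q) X f`. All three
  -- directions are nilpotent, so the path is polynomial of determinant one, and the velocities add
  -- up to `p e + q h + r f`.
  ⟨!![1 + C q * X + C (r - q) * X * ((1 + C q * X) * (C (p + q) * X) - C q * X),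
      (1 + C q * X) * (C (p + q) * X) - C q * X;
      C q * X + C (r - q) * X * (C q * X * (C (p + q) * X) + 1 - C q * X),
      C q * X * (C (p + q) * X) + 1 - C q * X], by
    rw [Matrix.det_fin_two_of]
    ring⟩

theorem slPath_coeff_zero (p q r : ℂ) (i j : Fin 2) :
    ((slPath p q r : Matrix _ _ ℂ[X]) i j).coeff 0 = (1 : Matrix (Fin 2) (Fin 2) ℂ) i j := by
  fin_cases i <;> fin_cases j <;> simp [slPath]

theorem slPath_coeff_one (p q r : ℂ) (i j : Fin 2) :
    ((slPath p q r : Matrix _ _ ℂ[X]) i j).coeff 1 = slMat p q r i j := by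
  fin_cases i <;> fin_cases j <;> simp [slPath, slMat, coeff_one, mul_assoc, mul_add, mul_sub, coeff_X_mul,
    add_mul, sub_mul]

variable {ι : Type*} (p q r : ι → ℂ)

/-- The polynomial family of representations sending each generator to `slPath`. -/
noncomputable def slFamily : FreeGroup ι →* SpecialLinearGroup (Fin 2) ℂ[X] :=
  FreeGroup.lift fun a => slPath (p a) (q a) (r a)

theorem slFamily_coeff_zero (g : FreeGroup ι) (i j : Fin 2) :
    ((slFamily p q r g : Matrix _ _ ℂ[X]) i j).coeff 0 = (1 : Matrix (Fin 2) (Fin 2) ℂ) i j := by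
  have h : (SpecialLinearGroup.map (constantCoeff (R := ℂ))).comp (slFamily p q r) = 1 := by
    refine FreeGroup.ext_hom _ _ fun a => Subtype.ext (Matrix.ext fun i j => ?_)
    change ((slFamily p q r (FreeGroup.of a) : Matrix _ _ ℂ[X]) i j).coeff 0 = _
    rw [slFamily, FreeGroup.lift_apply_of]
    exact slPath_coeff_zero _ _ _ i j
  exact congrFun₂ (congrArg Subtype.val (DFunLike.congr_fun h g)) i j

/-- `slFamily` as a multiplicative map to polynomials with matrix coefficients. -/
noncomputable def slFamilyPoly : FreeGroup ι →* (Matrix (Fin 2) (Fin 2) ℂ)[X] where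
  toFun g := matPolyEquiv (slFamily p q r g : Matrix _ _ ℂ[X])
  map_one' := by simp
  map_mul' g h := by simp

theorem slFamilyPoly_coeff (g : FreeGroup ι) (k : ℕ) (i j : Fin 2) :
    (slFamilyPoly p q r g).coeff k i j = ((slFamily p q r g : Matrix _ _ ℂ[X]) i j).coeff k :=
  matPolyEquiv_coeff_apply _ _ _ _

theorem X_dvd_slFamilyPoly_sub_one (g : FreeGroup ι) : X ∣ slFamilyPoly p q r g - 1 := by
  rw [X_dvd_iff, coeff_sub, coeff_one_zero, sub_eq_zero]
  ext i j
  rw [slFamilyPoly_coeff, slFamily_coeff_zero]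

theorem slFamilyPoly_of_coeff_one (a : ι) :
    (slFamilyPoly p q r (FreeGroup.of a)).coeff 1 = slMat (p a) (q a) (r a) := by
  ext i j
  rw [slFamilyPoly_coeff, slFamily, FreeGroup.lift_apply_of, slPath_coeff_one]

theorem isSlEvaluation_lead : IsSlEvaluation FreeGroup.of p q r
    (lead (slFamilyPoly p q r) (X_dvd_slFamilyPoly_sub_one p q r)) where
  gen a := by
    rw [gen, lead_cls, coeff_sub, slFamilyPoly_of_coeff_one, coeff_one, if_neg (by simp), sub_zero]
  ad k a w := by
    rw [lead_ad, slFamilyPoly_of_coeff_one]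

theorem mem_lcs_succ_of_X_pow_dvd [Fintype ι] [LinearOrder ι] {k : ℕ} (hk : k ≤ 3) {y : FreeGroup ι}
    (hy : y ∈ lcs (FreeGroup ι) k) (h : ∀ (p q r : ι → ℂ) (i j : Fin 2),
      X ^ (k + 2) ∣ (slFamily p q r y : Matrix _ _ ℂ[X]) i j - (1 : Matrix _ _ ℂ[X]) i j) :
    y ∈ lcs (FreeGroup ι) (k + 1) := by
  have hw : ∀ p q r, lead (slFamilyPoly p q r) (X_dvd_slFamilyPoly_sub_one p q r) k
      (cls y hy) = 0 := by
    intro p q r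
    rw [lead_cls]
    ext i j
    have h₁ := X_pow_dvd_iff.mp (h p q r i j) (k + 1) (by omega)
    rw [coeff_sub, Matrix.sub_apply, slFamilyPoly_coeff, Matrix.zero_apply, ← h₁, coeff_sub,
      coeff_one, if_neg (by omega), Matrix.zero_apply, Matrix.one_apply]
    split_ifs <;> simp [coeff_one]
  have hl := isSlEvaluation_lead (ι := ι)
  have hx := FreeGroup.closure_range_of ι
  rw [← cls_eq_zero_iff hy]
  interval_cases k
  · exact eq_zero_of_evaluation_zero hl hx _ hw
  · exact eq_zero_of_evaluation_one hl hx _ hw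
  · exact eq_zero_of_evaluation_two hl hx _ hw
  · exact eq_zero_of_evaluation_three hl hx _ hw

end Families

/-! ### Congruence filtrations of the representation algebra -/

section Comparison

open Matrix

/-- The universal representation, with values in matrices over the representation algebra. -/
noncomputable def univRep (m : ℕ) (G : Type*) [Group G] :
    G →* Matrix (Fin m) (Fin m) (repAlgebra m G) where
  toFun x := Matrix.of fun i j => repCoord i j x
  map_one' := by
    ext i j : 1
    have h := repS_one (G := G) i j
    rw [repS, sub_eq_zero] at h
    rw [Matrix.of_apply, h, Matrix.one_apply]
  map_mul' x y := by
    ext i j : 1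
    rw [Matrix.of_apply, repCoord_mul, Matrix.mul_apply]
    rfl

theorem univRep_sub_one_apply {m : ℕ} {G : Type*} [Group G] (x : G) (i j : Fin m) :
    (univRep m G x - 1) i j = repS i j x := by
  rw [Matrix.sub_apply, Matrix.one_apply]
  rfl

theorem univRep_sub_univRep_apply {m : ℕ} {G : Type*} [Group G] (x y : G) (i j : Fin m) :
    (univRep m G x - univRep m G y) i j = repS i j x - repS i j y := by
  rw [← univRep_sub_one_apply, ← univRep_sub_one_apply, ← Matrix.sub_apply, sub_sub_sub_cancel_right]

/-- Matrices with all entries in an ideal. -/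
def matrixAddSubgroup (m : ℕ) {R : Type*} [CommRing R] (I : Ideal R) :
    AddSubgroup (Matrix (Fin m) (Fin m) R) where
  carrier := {A | ∀ i j, A i j ∈ I}
  zero_mem' _ _ := I.zero_mem
  add_mem' hA hB i j := I.add_mem (hA i j) (hB i j)
  neg_mem' hA i j := I.neg_mem (hA i j)

theorem mul_mem_matrixAddSubgroup {m : ℕ} {R : Type*} [CommRing R] {I I' : Ideal R}
    {A B : Matrix (Fin m) (Fin m) R} (hA : A ∈ matrixAddSubgroup m I)
    (hB : B ∈ matrixAddSubgroup m I') : A * B ∈ matrixAddSubgroup m (I * I') := fun i j => by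
  rw [Matrix.mul_apply]
  exact Ideal.sum_mem _ fun l _ => Ideal.mul_mem_mul (hA i l) (hB l j)

theorem mul_left_mem_matrixAddSubgroup {m : ℕ} {R : Type*} [CommRing R] {I : Ideal R}
    (A : Matrix (Fin m) (Fin m) R) {B : Matrix (Fin m) (Fin m) R}
    (hB : B ∈ matrixAddSubgroup m I) : A * B ∈ matrixAddSubgroup m I := fun i j => by
  rw [Matrix.mul_apply]
  exact Ideal.sum_mem _ fun l _ => Ideal.mul_mem_left _ _ (hB l j)

theorem mul_right_mem_matrixAddSubgroup {m : ℕ} {R : Type*} [CommRing R] {I : Ideal R}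
    {A : Matrix (Fin m) (Fin m) R} (hA : A ∈ matrixAddSubgroup m I)
    (B : Matrix (Fin m) (Fin m) R) : A * B ∈ matrixAddSubgroup m I := fun i j => by
  rw [Matrix.mul_apply]
  exact Ideal.sum_mem _ fun l _ => Ideal.mul_mem_right _ _ (hA i l)

variable {m n : ℕ}

theorem univRep_sub_one_mem {k : ℕ} {y : FreeGroup (Fin n)} (hy : y ∈ lcs (FreeGroup (Fin n)) k) :
    univRep m _ y - 1 ∈ matrixAddSubgroup m (repIdeal m n ^ (k + 1)) := by
  refine (univRep m (FreeGroup (Fin n))).sub_one_mem_of_mem_lcs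
    (fun k => matrixAddSubgroup m (repIdeal m n ^ k)) ?_ ?_ ?_ ?_ hy
  · exact fun k s a ha => mul_left_mem_matrixAddSubgroup s ha
  · exact fun k s a ha => mul_right_mem_matrixAddSubgroup ha s
  · intro k a ha b hb
    have h₁ := mul_mem_matrixAddSubgroup ha hb
    have h₂ := mul_mem_matrixAddSubgroup hb ha
    rw [← pow_add] at h₁ h₂
    rw [add_comm 1] at h₂
    exact ⟨h₁, h₂⟩
  · intro g i j
    rw [univRep_sub_one_apply, pow_one]
    exact repS_mem_repIdeal g i j

theorem mem_lcs_succ_of_repS_mem (hm : 2 ≤ m) {k : ℕ} (hk : k ≤ 3) {y : FreeGroup (Fin n)}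
    (hy : y ∈ lcs (FreeGroup (Fin n)) k)
    (h : ∀ i j : Fin m, repS i j y ∈ repIdeal m n ^ (k + 2)) :
    y ∈ lcs (FreeGroup (Fin n)) (k + 1) := by
  obtain ⟨l, rfl⟩ := Nat.exists_eq_add_of_le hm
  refine mem_lcs_succ_of_X_pow_dvd hk hy fun p q r i j => ?_
  obtain ⟨Θ, hΘ⟩ := exists_ringHom_repCoord ((blockSL l _).comp (slFamily p q r))
  have hΘS : ∀ i j x, Θ (repS i j x) =
      blockMat l (slFamily p q r x : Matrix _ _ _) i j - (1 : Matrix _ _ _) i j := by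
    intro i j x
    rw [repS, map_sub, hΘ, Matrix.one_apply, apply_ite Θ, map_one, map_zero]
    rfl
  -- The family is trivial at `X = 0`, so every generator of the ideal maps to a multiple of `X`.
  have hJ : (repIdeal (2 + l) n).map Θ ≤ Ideal.span {Polynomial.X} := by
    rw [repIdeal, Ideal.map_span, Ideal.span_le]
    rintro _ ⟨_, ⟨i, j, a, rfl⟩, rfl⟩
    rw [SetLike.mem_coe, hΘS]
    refine blockMat_sub_one_mem (fun i j => ?_) i j
    rw [Ideal.mem_span_singleton, Polynomial.X_dvd_iff, Polynomial.coeff_sub,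
      slFamily_coeff_zero, sub_eq_zero, Matrix.one_apply, Matrix.one_apply]
    split_ifs <;> simp
  have h₁ := Ideal.mem_map_of_mem Θ (h (Fin.castAdd l i) (Fin.castAdd l j))
  rw [Ideal.map_pow, hΘS, blockMat_apply_castAdd,
    show (1 : Matrix (Fin (2 + l)) (Fin (2 + l)) (Polynomial ℂ)) (Fin.castAdd l i)
      (Fin.castAdd l j) = (1 : Matrix _ _ _) i j by simp [Matrix.one_apply]] at h₁
  have h₂ := Ideal.pow_right_mono hJ (k + 2) h₁
  rwa [Ideal.span_singleton_pow, Ideal.mem_span_singleton] at h₂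

theorem mem_repFiltration_iff {k : ℕ} {σ : MulAut (FreeGroup (Fin n))} :
    σ ∈ repFiltration m n k ↔ ∀ f ∈ repIdeal m n,
      repAct m (FreeGroup (Fin n)) σ f - f ∈ repIdeal m n ^ (k + 1) := by
  rw [repFiltration, MonoidHom.mem_ker, ← Units.val_inj]
  constructor
  · intro h f hf
    have := LinearMap.congr_fun h (Submodule.Quotient.mk ⟨f, hf⟩)
    exact (Submodule.Quotient.eq (powInIdeal (repIdeal m n) (k + 1))).mp this
  · intro h
    refine LinearMap.ext fun f => ?_
    induction f using Submodule.Quotient.induction_on with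
    | H f => exact (Submodule.Quotient.eq (powInIdeal (repIdeal m n) (k + 1))).mpr (h f f.2)

theorem mem_andreadakisJohnson_iff {G : Type*} [Group G] {k : ℕ} {σ : MulAut G} :
    σ ∈ andreadakisJohnson G k ↔ ∀ x, x⁻¹ * σ x ∈ lcs G k := by
  rw [andreadakisJohnson, MonoidHom.mem_ker]
  constructor
  · intro h x
    have := DFunLike.congr_fun h (QuotientGroup.mk x)
    exact QuotientGroup.eq.mp this.symm
  · intro h
    ext x
    induction x using QuotientGroup.induction_on with
    | H x => exact (QuotientGroup.eq.mpr (h x)).symm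

/-- Acting trivially modulo `I` on the generators propagates to products, because `σ(fg) - fg =
σ(f)(σ(g) - g) + g(σ(f) - f)`. -/
theorem repAct_sub_mem_of_coord {I : Ideal (repAlgebra m (FreeGroup (Fin n)))}
    {σ : MulAut (FreeGroup (Fin n))}
    (h : ∀ (i j : Fin m) x, repS i j (σ x) - repS i j x ∈ I)
    (f : repAlgebra m (FreeGroup (Fin n))) : repAct m _ σ f - f ∈ I := by
  obtain ⟨f, hf⟩ := f
  induction hf using Algebra.adjoin_induction with
  | mem f hf =>
    obtain ⟨i, j, x, rfl⟩ := hf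
    have h' := h i j x
    rw [repS, repS, sub_sub_sub_cancel_right] at h'
    exact h'
  | algebraMap q =>
    have e : repAct m _ σ (algebraMap ℚ _ q) - algebraMap ℚ _ q = 0 := by
      rw [AlgHom.commutes, sub_self]
    exact e ▸ I.zero_mem
  | add f g hf hg hf' hg' =>
    have e := map_add (repAct m _ σ) ⟨f, hf⟩ ⟨g, hg⟩
    have := add_mem hf' hg'
    rw [← add_sub_add_comm, ← e] at this
    exact this
  | mul f g hf hg hf' hg' =>
    have e := map_mul (repAct m _ σ) ⟨f, hf⟩ ⟨g, hg⟩
    have := add_mem (I.mul_mem_left (repAct m _ σ ⟨f, hf⟩) hg') (I.mul_mem_left ⟨g, hg⟩ hf')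
    have e' : repAct m _ σ (⟨f, hf⟩ * ⟨g, hg⟩) - ⟨f, hf⟩ * ⟨g, hg⟩ ∈ I := by
      rw [e]
      convert this using 1
      ring
    exact e'

theorem repFiltration_le_andreadakisJohnson (hm : 2 ≤ m) {k : ℕ} (hk : k ≤ 4) :
    repFiltration m n k ≤ andreadakisJohnson (FreeGroup (Fin n)) k := by
  intro σ hσ
  rw [mem_repFiltration_iff] at hσ
  rw [mem_andreadakisJohnson_iff]
  intro x
  have hy : ∀ i j : Fin m, repS i j (x⁻¹ * σ x) ∈ repIdeal m n ^ (k + 1) := by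
    have h₁ : univRep m _ (σ x) - univRep m _ x ∈
        matrixAddSubgroup m (repIdeal m n ^ (k + 1)) := by
      intro i j
      rw [univRep_sub_univRep_apply, ← repAct_repS]
      exact hσ _ (repS_mem_repIdeal x i j)
    have h₂ := mul_left_mem_matrixAddSubgroup (univRep m _ x⁻¹) h₁
    rw [mul_sub, ← map_mul, ← map_mul, inv_mul_cancel, map_one] at h₂
    intro i j
    rw [← univRep_sub_one_apply]
    exact h₂ i j
  -- Passing from `j` to `j + 1` requires `𝔍 ^ (j + 2)`, which contains `𝔍 ^ (k + 1)` as `j + 1 ≤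
  -- k`. With `k ≤ 4` only `j ≤ 3` occurs, the range covered by the evaluation on `sl₂`.
  have key : ∀ j ≤ k, x⁻¹ * σ x ∈ lcs (FreeGroup (Fin n)) j := by
    intro j
    induction j with
    | zero => exact fun _ => mem_lcs_zero _
    | succ j ih =>
      intro hj
      exact mem_lcs_succ_of_repS_mem hm (by omega) (ih (by omega)) fun i l =>
        Ideal.pow_le_pow_right (by omega) (hy i l)
  exact key k le_rfl

theorem andreadakisJohnson_le_repFiltration (k : ℕ) :
    andreadakisJohnson (FreeGroup (Fin n)) k ≤ repFiltration m n k := by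
  intro σ hσ
  rw [mem_andreadakisJohnson_iff] at hσ
  rw [mem_repFiltration_iff]
  refine fun f _ => repAct_sub_mem_of_coord (fun i j x => ?_) f
  have h := mul_left_mem_matrixAddSubgroup (univRep m _ x) (univRep_sub_one_mem (m := m) (hσ x))
  rw [mul_sub, ← map_mul, mul_inv_cancel_left, mul_one] at h
  rw [← univRep_sub_univRep_apply]
  exact h i j

end Comparison

theorem mainTheorem4 (n m k : ℕ) (hm : 2 ≤ m) (hk : 1 ≤ k) (hk' : k ≤ 4) :
    repFiltration m n k = andreadakisJohnson (FreeGroup (Fin n)) k :=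
  le_antisymm (repFiltration_le_andreadakisJohnson hm hk') (andreadakisJohnson_le_repFiltration k)
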